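/- Define polynomials $m_d=m_d(u_0,u_1,\dots,u_{2d})$, $d\ge 0$, by the requirement that the series $b(\lambda)=1+\sum_{d\ge 0}(2d+1)!!\,m_d\,\lambda^{-d-1}$ satisfies $$b\,\partial^2(b)-\tfrac12\,\partial(b)^2-2(\lambda-2u_0)\,b^2=-2\lambda,\qquad \partial:=\sum_{i\ge 0}u_{i+1}\frac{\partial}{\partial u_i}.$$ (For example $m_0=u_0$, $m_1=\frac12u_0^2+\frac1{12}u_2$.) For $d\ge1$, the $d$-th equation of the Painlevé II hierarchy with parameter $\alpha_d=\frac12$ is $$2^{2d-1}(2d-1)!!\,(\partial_X+2V)\Bigl(m_{d-1}\bigl(\tfrac{V_X-V^2}{2},\tfrac{(V_X-V^2)_X}{2},\dots\bigr)\Bigr)-VX-\tfrac12=0 .$$ **Theorem.** For each $d\ge 1$ this equation has a unique formal solution of the form $$V(X)=-\sum_{n=0}^{\infty}\frac{v_{d,n}}{X^{(2d+1)n+1}},\qquad v_{d,n}\in\mathbb C,\quad v_{d,0}=\tfrac12,$$ and its coefficients satisfy $$v_{d,n}\;\sim\;\frac1\pi\,\frac{((2d+1)n-1)!}{(2d+1)^{n-1}\,(n-1)!}\qquad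 (n\to\infty).$$ -/

import Mathlib

open scoped Nat

noncomputable section

namespace PainleveII

/-- Differential polynomials in the jet variables `u₀, u₁, u₂, …`. -/
abbrev DiffPoly : Type := MvPolynomial ℕ ℂ

/-- The derivation `∂ = ∑ u_{i+1} ∂/∂u_i`. -/
def del : Derivation ℂ DiffPoly DiffPoly :=
  MvPolynomial.mkDerivation ℂ fun i => MvPolynomial.X (i + 1)

/-- The coefficient of `λ^{-k}` in `b(λ)`: the defining equation
`b ∂²(b) - ½ ∂(b)² - 2 (λ - 2 u₀) b² = -2 λ`, `b = 1 + O(λ⁻¹)`, solved order by order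
(see `isGeneratingFamily_iff` below). -/
def bCoeff : ℕ → DiffPoly
  | 0 => 1
  | k + 1 =>
    MvPolynomial.C (1 / 4) *
      ((∑ i : Fin (k + 1),
          (bCoeff i * del (del (bCoeff (k - i)))
            - MvPolynomial.C (1 / 2) * (del (bCoeff i) * del (bCoeff (k - i)))
            + 4 * MvPolynomial.X 0 * (bCoeff i * bCoeff (k - i))))
        - 2 * ∑ i : Fin k, bCoeff (i + 1) * bCoeff (k - i))

/-- The polynomials `m_d`, given by `b(λ) = 1 + ∑_{d ≥ 0} (2d+1)!! m_d λ^{-(d+1)}`. -/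
def m (d : ℕ) : DiffPoly :=
  MvPolynomial.C (1 / ((2 * d + 1)‼ : ℂ)) * bCoeff (d + 1)

/-- The series `1 + ∑_{d ≥ 0} (2d+1)!! p_d z^{d+1}` in `z = λ⁻¹`, for a family `p`. -/
def genSeries (p : ℕ → DiffPoly) : PowerSeries DiffPoly :=
  PowerSeries.mk fun k =>
    match k with
    | 0 => 1
    | d + 1 => MvPolynomial.C ((2 * d + 1)‼ : ℂ) * p d

/-- `∂` acting coefficientwise on series in `z = λ⁻¹`. -/
def delSeries (F : PowerSeries DiffPoly) : PowerSeries DiffPoly :=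
  PowerSeries.mk fun k => del (PowerSeries.coeff k F)

/-- The equation `b ∂²(b) - ½ ∂(b)² - 2 (λ - 2 u₀) b² = -2 λ` for the generating series `b` of the
family `p`, written in `z = λ⁻¹` after multiplication of both sides by `z`. -/
def IsGeneratingFamily (p : ℕ → DiffPoly) : Prop :=
  let b := genSeries p
  let z : PowerSeries DiffPoly := PowerSeries.X
  z * (b * delSeries (delSeries b)
      - PowerSeries.C (MvPolynomial.C (1 / 2)) * delSeries b ^ 2)
    - 2 * (1 - 2 * PowerSeries.C (MvPolynomial.X 0) * z) * b ^ 2 = -2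

theorem bCoeff_succ (k : ℕ) : bCoeff (k + 1) =
    MvPolynomial.C (1 / 4) *
      ((∑ i ∈ Finset.range (k + 1),
          (bCoeff i * del (del (bCoeff (k - i)))
            - MvPolynomial.C (1 / 2) * (del (bCoeff i) * del (bCoeff (k - i)))
            + 4 * MvPolynomial.X 0 * (bCoeff i * bCoeff (k - i))))
        - 2 * ∑ i ∈ Finset.range k, bCoeff (i + 1) * bCoeff (k - i)) := by
  rw [bCoeff, Finset.sum_range, Finset.sum_range]

theorem four_inv_cancel : (MvPolynomial.C (1 / 4) : DiffPoly) * 4 = 1 := by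
  have h : (4 : DiffPoly) = MvPolynomial.C 4 := (map_ofNat MvPolynomial.C 4).symm
  rw [h, ← MvPolynomial.C_mul]; norm_num

/-- A series `b` with constant term `1` solves the equation exactly if its coefficients satisfy
the recursion of `bCoeff`. -/
theorem series_eq_iff (b : PowerSeries DiffPoly) (h0 : PowerSeries.coeff 0 b = 1) :
    (PowerSeries.X * (b * delSeries (delSeries b)
      - PowerSeries.C (MvPolynomial.C (1 / 2)) * delSeries b ^ 2)
    - 2 * (1 - 2 * PowerSeries.C (MvPolynomial.X 0) * PowerSeries.X) * b ^ 2 = -2) ↔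
    ∀ k, PowerSeries.coeff k b = bCoeff k := by
  have key : ∀ k, PowerSeries.coeff (k + 1)
      (PowerSeries.X * (b * delSeries (delSeries b)
        - PowerSeries.C (MvPolynomial.C (1 / 2)) * delSeries b ^ 2)
      - 2 * (1 - 2 * PowerSeries.C (MvPolynomial.X 0) * PowerSeries.X) * b ^ 2) =
      (∑ i ∈ Finset.range (k + 1),
          (PowerSeries.coeff i b * del (del (PowerSeries.coeff (k - i) b))
            - MvPolynomial.C (1 / 2)
              * (del (PowerSeries.coeff i b) * del (PowerSeries.coeff (k - i) b))
            + 4 * MvPolynomial.X 0 * (PowerSeries.coeff i b * PowerSeries.coeff (k - i) b)))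
        - 2 * (∑ i ∈ Finset.range k, PowerSeries.coeff (i + 1) b * PowerSeries.coeff (k - i) b)
        - 4 * PowerSeries.coeff (k + 1) b := by
    intro k
    have e : PowerSeries.X * (b * delSeries (delSeries b)
        - PowerSeries.C (MvPolynomial.C (1 / 2)) * delSeries b ^ 2)
      - 2 * (1 - 2 * PowerSeries.C (MvPolynomial.X 0) * PowerSeries.X) * b ^ 2 =
      PowerSeries.X * (b * delSeries (delSeries b)
        - PowerSeries.C (MvPolynomial.C (1 / 2)) * (delSeries b * delSeries b)
        + PowerSeries.C (4 * MvPolynomial.X 0) * (b * b))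
      - PowerSeries.C 2 * (b * b) := by
      have h2 : (PowerSeries.C (2 : DiffPoly)) = 2 := map_ofNat PowerSeries.C 2
      have h4 : (PowerSeries.C (4 : DiffPoly)) = 4 := map_ofNat PowerSeries.C 4
      rw [map_mul, h2, h4]; ring
    rw [e, map_sub, PowerSeries.coeff_succ_X_mul, PowerSeries.coeff_C_mul, map_add, map_sub,
      PowerSeries.coeff_C_mul, PowerSeries.coeff_C_mul]
    simp only [PowerSeries.coeff_mul, delSeries, PowerSeries.coeff_mk]
    simp only [Finset.Nat.sum_antidiagonal_eq_sum_range_succ_mk]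
    rw [Finset.sum_range_succ' _ (k + 1),
      Finset.sum_range_succ (fun i => PowerSeries.coeff (i + 1) b * _) k, Finset.sum_add_distrib,
      Finset.sum_sub_distrib, Finset.mul_sum, Finset.mul_sum]
    simp only [Nat.add_sub_add_right, Nat.sub_self, Nat.sub_zero, h0]
    ring
  have key0 : PowerSeries.coeff 0
      (PowerSeries.X * (b * delSeries (delSeries b)
        - PowerSeries.C (MvPolynomial.C (1 / 2)) * delSeries b ^ 2)
      - 2 * (1 - 2 * PowerSeries.C (MvPolynomial.X 0) * PowerSeries.X) * b ^ 2) = -2 := by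
    have h0' : PowerSeries.constantCoeff b = 1 := by simpa using h0
    have h2 : PowerSeries.constantCoeff (2 : PowerSeries DiffPoly) = 2 := map_ofNat _ 2
    simp [h0', h2]
  have m2 : ∀ k, PowerSeries.coeff (k + 1) (-2 : PowerSeries DiffPoly) = 0 := by
    intro k
    have h2 : (-2 : PowerSeries DiffPoly) = PowerSeries.C (-2 : DiffPoly) := by
      rw [map_neg, map_ofNat]
    rw [h2, PowerSeries.coeff_C]; simp
  constructor
  · intro h k
    induction k using Nat.strong_induction_on with
    | _ k ih =>
      cases k with
      | zero => rw [h0, bCoeff]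
      | succ k =>
        have hk := key k
        rw [h, m2] at hk
        rw [bCoeff_succ]
        have s1 : ∀ i ∈ Finset.range (k + 1), PowerSeries.coeff i b = bCoeff i ∧
            PowerSeries.coeff (k - i) b = bCoeff (k - i) := fun i hi => by
          have := Finset.mem_range.1 hi
          exact ⟨ih _ (by omega), ih _ (by omega)⟩
        have s2 : ∀ i ∈ Finset.range k, PowerSeries.coeff (i + 1) b = bCoeff (i + 1) ∧
            PowerSeries.coeff (k - i) b = bCoeff (k - i) := fun i hi => by
          have := Finset.mem_range.1 hi
          exact ⟨ih _ (by omega), ih _ (by omega)⟩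
        rw [Finset.sum_congr rfl fun i hi => by rw [(s1 i hi).1, (s1 i hi).2],
          Finset.sum_congr (s₁ := Finset.range k) rfl
            fun i hi => by rw [(s2 i hi).1, (s2 i hi).2]] at hk
        linear_combination MvPolynomial.C (1 / 4) * hk
          - PowerSeries.coeff (k + 1) b * four_inv_cancel
  · intro h
    ext1 k
    cases k with
    | zero =>
      rw [key0, PowerSeries.coeff_zero_eq_constantCoeff_apply, map_neg, map_ofNat]
    | succ k =>
      rw [key, m2]
      simp only [h]
      rw [bCoeff_succ k]
      generalize (∑ i ∈ Finset.range (k + 1), _ : DiffPoly) = S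
      generalize (∑ i ∈ Finset.range k, _ : DiffPoly) = T
      linear_combination (-(S - 2 * T)) * four_inv_cancel

/-- The family `m` is the unique one whose generating series satisfies the defining equation. -/
theorem isGeneratingFamily_iff (p : ℕ → DiffPoly) : IsGeneratingFamily p ↔ p = m := by
  have hC : ∀ d : ℕ, (MvPolynomial.C ((2 * d + 1)‼ : ℂ) : DiffPoly) *
      MvPolynomial.C (1 / ((2 * d + 1)‼ : ℂ)) = 1 := fun d => by
    have : ((2 * d + 1)‼ : ℂ) ≠ 0 := by exact_mod_cast (Nat.doubleFactorial_pos _).ne'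
    rw [← MvPolynomial.C_mul, mul_one_div_cancel this, MvPolynomial.C_1]
  unfold IsGeneratingFamily
  rw [series_eq_iff _ (by simp [genSeries])]
  constructor
  · intro h
    funext d
    have hd := h (d + 1)
    simp only [genSeries, PowerSeries.coeff_mk] at hd
    rw [m, ← hd, ← mul_assoc, mul_comm (MvPolynomial.C _) (MvPolynomial.C _), hC, one_mul]
  · rintro rfl k
    cases k with
    | zero => simp [genSeries, bCoeff]
    | succ d =>
      simp only [genSeries, PowerSeries.coeff_mk]
      rw [m, ← mul_assoc, hC, one_mul]

/-- Formal Laurent series in `X⁻¹` over `ℂ`: the coefficient at `k` is that of `X^{-k}`. -/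
abbrev InvSeries : Type := LaurentSeries ℂ

/-- The element `X` of the ring of Laurent series in `X⁻¹`. -/
def varX : InvSeries := HahnSeries.single (-1) 1

/-- The derivative `∂_X`; with `z = X⁻¹` it is `-z² d/dz`. -/
def dX (F : InvSeries) : InvSeries :=
  -(HahnSeries.single 2 1 * LaurentSeries.derivative ℂ F)

/-- `p(f, f_X, f_XX, …)` for a differential polynomial `p`. -/
def evalJet (p : DiffPoly) (f : InvSeries) : InvSeries :=
  MvPolynomial.eval₂ HahnSeries.C (fun i => dX^[i] f) p

/-- The left-hand side of the `d`-th equation of the Painlevé II hierarchy with parameter `α`: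
`2^{2d-1} (2d-1)!! (∂_X + 2V) (m_{d-1}((V_X-V²)/2, (V_X-V²)_X/2, …)) - V X - α`, for `d ≥ 1`. -/
def p2Lhs (d : ℕ) (α : ℂ) (V : InvSeries) : InvSeries :=
  let M : InvSeries := evalJet (m (d - 1)) (HahnSeries.C (1 / 2) * (dX V - V ^ 2))
  HahnSeries.C ((2 : ℂ) ^ (2 * d - 1) * ((2 * d - 1)‼ : ℂ)) * (dX M + 2 * V * M)
    - V * varX - HahnSeries.C α

/-- The series `-∑_{n ≥ 0} v_n X^{-((2d+1)n+1)}`, i.e. `-z ∑ v_n (z^{2d+1})^n` with `z = X⁻¹`. -/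
def ansatz (d : ℕ) (v : ℕ → ℂ) : InvSeries :=
  HahnSeries.ofPowerSeries ℤ ℂ
    (-(PowerSeries.X * PowerSeries.expand (2 * d + 1) (Nat.succ_ne_zero _) (PowerSeries.mk v)))

/-- `v` is the coefficient sequence of a formal solution
`V(X) = -∑ v_n X^{-((2d+1)n+1)}`, `v_0 = 1/2`, of the `d`-th Painlevé II equation with
`α_d = 1/2`. -/
def IsFormalSolution (d : ℕ) (v : ℕ → ℂ) : Prop :=
  v 0 = 1 / 2 ∧ p2Lhs d (1 / 2) (ansatz d v) = 0

end PainleveII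

end

noncomputable section

namespace PainleveII

/-! ### The derivation `∂_X` on series in `X⁻¹` -/

/-! Put u = (V' - V²)/2, let b_k be the coefficients of b(λ) at u, and R = 2^{2d-1} b_d - X/2. For α
= 1/2 the equation says R' + 2VR = 0. Such an R is killed by L = ∂³ + 8u∂ + 4u', and the Lenard
recursion 4b_{k+1}' = L b_k turns L R = 0 into the similarity equation 4^d b_{d+1}' = 2u + X u'.
Together with the recursion this determines u from its leading coefficient 1/8, which v_0 = 1/2
forces. Hence R is known, and so is V = -R'/(2R) (`solution_unique`). Conversely, for this u and R
the first integral 2RR'' - R'² + 8uR² of L R = 0 vanishes, which gives back u = (V' - V²)/2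
(`solution_exists`).

For the asymptotics write b_k = ∑ β_{k,n} X^{-((2d+1)n+2k)} and divide β_{k,n} by its expected size
(`normArray`). The Lenard recursion makes the quotient nondecreasing in k ≥ 1. For n = 0 it is a
Wallis quotient with limit 2/π as k → ∞. The identity `merging` compares index n + 1 at k with index
n at k + d up to a vanishing error, so the limit in k is 2/π for every n (`tendsto_normArray`). The
increments in k are at most 2/(n+k+1)² (`normArray_step_le_sq`). Summing them shows that the
quotient at fixed k = d also tends to 2/π as n → ∞.

Finally VR = -R'/2 expresses v_{n+1} as (2d+1)(n+1)/2 · 4^d β_{d,n} plus a convolution that is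
smaller by a factor O(1/n); the first term supplies 1/π. -/

theorem coeff_dX (F : InvSeries) (n : ℤ) :
    (dX F).coeff n = -((n - 1 : ℤ) : ℂ) * F.coeff (n - 1) := by
  rw [dX, HahnSeries.coeff_neg, HahnSeries.coeff_single_mul, LaurentSeries.derivative_apply,
    LaurentSeries.hasseDeriv_coeff, Nat.cast_one, Ring.choose_one_right,
    show n - 2 + 1 = n - 1 by ring]
  simp only [one_mul, zsmul_eq_mul, neg_mul]

/-- The Euler operator `X ∂_X`. -/
def eulerOp (F : InvSeries) : InvSeries := varX * dX F

theorem coeff_eulerOp (F : InvSeries) (n : ℤ) :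
    (eulerOp F).coeff n = -(n : ℂ) * F.coeff n := by
  rw [eulerOp, varX, HahnSeries.coeff_single_mul, coeff_dX]
  simp

theorem support_eulerOp (F : InvSeries) : (eulerOp F).support ⊆ F.support := by
  intro n hn h
  exact hn (by rw [coeff_eulerOp, h, mul_zero])

/-- Unlike ∂_X, the operator X ∂_X acts diagonally on coefficients and does not enlarge supports.
All three products are therefore sums over one antidiagonal, and the Leibniz rule reduces to
additivity of exponents. -/
theorem eulerOp_mul (F G : InvSeries) : eulerOp (F * G) = F * eulerOp G + G * eulerOp F := by
  ext n
  rw [mul_comm G, coeff_eulerOp, HahnSeries.coeff_add,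
    HahnSeries.coeff_mul_left' F.isPWO_support (support_eulerOp F),
    HahnSeries.coeff_mul_right' G.isPWO_support (support_eulerOp G), HahnSeries.coeff_mul,
    Finset.mul_sum, ← Finset.sum_add_distrib]
  refine Finset.sum_congr rfl fun ij hij => ?_
  have h : ij.1 + ij.2 = n := by simpa using (Finset.mem_antidiagonal.1 hij).2.2
  rw [coeff_eulerOp, coeff_eulerOp, ← h]
  push_cast
  ring

theorem single_mul_varX : HahnSeries.single 1 1 * varX = 1 := by
  rw [varX, HahnSeries.single_mul_single]; simp

theorem dX_eq (F : InvSeries) : dX F = HahnSeries.single 1 1 * eulerOp F := by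
  rw [eulerOp, ← mul_assoc, single_mul_varX, one_mul]

theorem dX_add (F G : InvSeries) : dX (F + G) = dX F + dX G := by
  ext n
  rw [coeff_dX, HahnSeries.coeff_add, HahnSeries.coeff_add, coeff_dX, coeff_dX]
  ring

/-- `∂_X` as an additive map. -/
def derX : InvSeries →+ InvSeries := AddMonoidHom.mk' dX dX_add

theorem derX_apply (F : InvSeries) : derX F = dX F := rfl

theorem derX_mul (F G : InvSeries) : derX (F * G) = F * derX G + G * derX F := by
  rw [derX_apply, derX_apply, derX_apply, dX_eq, dX_eq, dX_eq, eulerOp_mul]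
  ring

theorem derX_varX : derX varX = 1 := by
  ext n
  rw [derX_apply, coeff_dX, varX, HahnSeries.coeff_one]
  by_cases h : n = 0
  · subst h; simp
  · rw [HahnSeries.coeff_single_of_ne (by omega), if_neg h, mul_zero]

theorem derX_C (a : ℂ) : derX (HahnSeries.C a) = 0 := by
  ext n
  rw [derX_apply, coeff_dX, HahnSeries.coeff_zero, HahnSeries.C_apply]
  by_cases h : n - 1 = 0
  · rw [h]; simp
  · rw [HahnSeries.coeff_single_of_ne h, mul_zero]

theorem derX_natCast (n : ℕ) : derX (n : InvSeries) = 0 := by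
  rw [← map_natCast (HahnSeries.C : ℂ →+* InvSeries), derX_C]

theorem derX_one : derX (1 : InvSeries) = 0 := by simpa using derX_natCast 1

theorem derX_two : derX (2 : InvSeries) = 0 := derX_natCast 2

theorem derX_four : derX (4 : InvSeries) = 0 := derX_natCast 4

theorem derX_eight : derX (8 : InvSeries) = 0 := derX_natCast 8

theorem derX_C_mul (a : ℂ) (F : InvSeries) :
    derX (HahnSeries.C a * F) = HahnSeries.C a * derX F := by
  rw [derX_mul, derX_C, mul_zero, add_zero]

/-! ### Evaluation of differential polynomials -/

/-- `evalJet` as a ring homomorphism. -/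
def evalHom (f : InvSeries) : DiffPoly →+* InvSeries :=
  MvPolynomial.eval₂Hom HahnSeries.C fun i => dX^[i] f

theorem evalHom_apply (f : InvSeries) (p : DiffPoly) : evalHom f p = evalJet p f := rfl

theorem evalHom_C (f : InvSeries) (a : ℂ) : evalHom f (MvPolynomial.C a) = HahnSeries.C a :=
  MvPolynomial.eval₂_C _ _ _

theorem evalHom_X (f : InvSeries) (i : ℕ) : evalHom f (MvPolynomial.X i) = dX^[i] f :=
  MvPolynomial.eval₂_X _ _ _

theorem del_X (i : ℕ) : del (MvPolynomial.X i) = MvPolynomial.X (i + 1) := by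
  simp [del, MvPolynomial.mkDerivation_X]

theorem del_C (a : ℂ) : del (MvPolynomial.C a) = 0 := MvPolynomial.derivation_C _ _

theorem derX_evalHom (f : InvSeries) (p : DiffPoly) :
    derX (evalHom f p) = evalHom f (del p) := by
  induction p using MvPolynomial.induction_on with
  | C a => rw [evalHom_C, derX_C, del_C, map_zero]
  | add p q hp hq => rw [map_add, map_add, map_add, map_add, hp, hq]
  | mul_X p i hp =>
    rw [map_mul, derX_mul, Derivation.leibniz, hp, del_X, smul_eq_mul, smul_eq_mul, map_add,
      map_mul, map_mul, evalHom_X, evalHom_X,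
      Function.iterate_succ_apply', derX_apply]

/-! ### The Lenard recursion -/

theorem coeff_delSeries (F : PowerSeries DiffPoly) (k : ℕ) :
    PowerSeries.coeff k (delSeries F) = del (PowerSeries.coeff k F) :=
  PowerSeries.coeff_mk _ _

/-- `∂` on series in `z` as a derivation. -/
def delSeriesDer : Derivation ℂ (PowerSeries DiffPoly) (PowerSeries DiffPoly) :=
  Derivation.mk'
    { toFun := delSeries
      map_add' := fun F G => by ext1 k; simp [coeff_delSeries]
      map_smul' := fun a F => by ext1 k; simp [coeff_delSeries] }
    (by
      intro F G
      ext1 k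
      change PowerSeries.coeff k (delSeries (F * G)) =
        PowerSeries.coeff k (F * delSeries G + G * delSeries F)
      rw [mul_comm G, coeff_delSeries, map_add, PowerSeries.coeff_mul, PowerSeries.coeff_mul,
        PowerSeries.coeff_mul, map_sum, ← Finset.sum_add_distrib]
      refine Finset.sum_congr rfl fun ij _ => ?_
      rw [Derivation.leibniz, coeff_delSeries, coeff_delSeries, smul_eq_mul, smul_eq_mul]
      ring)

theorem delSeriesDer_apply (F : PowerSeries DiffPoly) : delSeriesDer F = delSeries F := rfl

theorem delSeriesDer_C (p : DiffPoly) :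
    delSeriesDer (PowerSeries.C p) = PowerSeries.C (del p) := by
  ext1 k
  rw [delSeriesDer_apply, coeff_delSeries, PowerSeries.coeff_C, PowerSeries.coeff_C]
  split_ifs <;> simp

theorem delSeriesDer_X : delSeriesDer (PowerSeries.X : PowerSeries DiffPoly) = 0 := by
  ext1 k
  rw [delSeriesDer_apply, coeff_delSeries, PowerSeries.coeff_X]
  split_ifs <;> simp

/-- The Lenard recursion `4 ∂b_{k+1} = ∂³b_k + 8 u₀ ∂b_k + 4 u₁ b_k`. -/
theorem lenard (k : ℕ) : 4 * del (bCoeff (k + 1)) = del (del (del (bCoeff k)))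
    + 8 * MvPolynomial.X 0 * del (bCoeff k) + 4 * MvPolynomial.X 1 * bCoeff k := by
  set b : PowerSeries DiffPoly := PowerSeries.mk bCoeff with hb
  have h0 : PowerSeries.coeff 0 b = 1 := by rw [hb, PowerSeries.coeff_mk, bCoeff]
  have hq := (series_eq_iff b h0).2 fun k => PowerSeries.coeff_mk _ _
  have hb0 : b ≠ 0 := fun h => by rw [h, map_zero] at h0; exact zero_ne_one h0
  have hhalf : (2 : PowerSeries DiffPoly) * PowerSeries.C (MvPolynomial.C (1 / 2)) = 1 := by
    have h2 : (2 : PowerSeries DiffPoly) = PowerSeries.C (MvPolynomial.C 2) := by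
      rw [map_ofNat, map_ofNat]
    rw [h2, ← map_mul, ← map_mul]; norm_num
  have hd := congrArg delSeriesDer hq
  have h2 : delSeriesDer (2 : PowerSeries DiffPoly) = 0 := delSeriesDer.map_natCast 2
  have h2' : delSeriesDer (-2 : PowerSeries DiffPoly) = 0 := by rw [map_neg, h2, neg_zero]
  simp only [← delSeriesDer_apply, map_sub, Derivation.leibniz, Derivation.leibniz_pow, smul_eq_mul,
    delSeriesDer_C, delSeriesDer_X, del_C, del_X, h2, h2', map_zero, Derivation.map_one_eq_zero,
    nsmul_eq_mul] at hd
  -- In the differentiated quadratic equation the products ∂b ∂²b cancel and every remaining term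
  -- contains b, which can be cancelled in a domain.
  have hlin : b * (PowerSeries.X * (delSeriesDer (delSeriesDer (delSeriesDer b))
      + PowerSeries.C (8 * MvPolynomial.X 0) * delSeriesDer b
      + PowerSeries.C (4 * MvPolynomial.X 1) * b)) = b * (PowerSeries.C 4 * delSeriesDer b) := by
    have h4 : (PowerSeries.C (4 : DiffPoly)) = 4 := map_ofNat PowerSeries.C 4
    have h8 : (PowerSeries.C (8 : DiffPoly)) = 8 := map_ofNat PowerSeries.C 8
    rw [map_mul, map_mul, h4, h8]
    push_cast at hd
    linear_combination hd + PowerSeries.X * delSeriesDer b *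
      delSeriesDer (delSeriesDer b) * hhalf
  have hc := congrArg (PowerSeries.coeff (k + 1)) (mul_left_cancel₀ hb0 hlin)
  rw [PowerSeries.coeff_succ_X_mul, PowerSeries.coeff_C_mul, map_add, map_add,
    PowerSeries.coeff_C_mul, PowerSeries.coeff_C_mul] at hc
  simp only [delSeriesDer_apply, coeff_delSeries, hb, PowerSeries.coeff_mk] at hc
  exact hc.symm

theorem bCoeff_one : bCoeff 1 = MvPolynomial.X 0 := by
  have h0 : bCoeff 0 = 1 := by rw [bCoeff]
  have h := four_inv_cancel
  rw [bCoeff_succ]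
  simp only [zero_add, Finset.range_one, Finset.sum_singleton, Finset.range_zero,
    Finset.sum_empty, h0, Derivation.map_one_eq_zero, map_zero]
  linear_combination MvPolynomial.X 0 * h

/-! ### Homogeneous series -/

/-- The series `∑ p_n X^{-((2d+1)n+s)}`. -/
def hser (d : ℕ) (s : ℤ) (p : PowerSeries ℂ) : InvSeries :=
  HahnSeries.single s 1 *
    HahnSeries.ofPowerSeries ℤ ℂ (PowerSeries.expand (2 * d + 1) (Nat.succ_ne_zero _) p)

theorem ofPowerSeries_coeff_neg (p : PowerSeries ℂ) {m : ℤ} (hm : m < 0) :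
    (HahnSeries.ofPowerSeries ℤ ℂ p).coeff m = 0 := by
  rw [HahnSeries.ofPowerSeries_apply]
  refine HahnSeries.embDomain_of_notMem_range ?_
  rintro ⟨n, hn⟩
  have : (n : ℤ) = m := hn
  omega

theorem coeff_hser (d : ℕ) (s : ℤ) (p : PowerSeries ℂ) (n : ℕ) :
    (hser d s p).coeff ((2 * d + 1) * n + s) = PowerSeries.coeff n p := by
  rw [hser, HahnSeries.coeff_single_mul, one_mul, add_sub_cancel_right,
    show ((2 * d + 1) * n : ℤ) = (((2 * d + 1) * n : ℕ) : ℤ) by push_cast; ring,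
    HahnSeries.ofPowerSeries_apply_coeff, PowerSeries.coeff_expand_mul]

theorem coeff_hser_of_ne (d : ℕ) (s : ℤ) (p : PowerSeries ℂ) (m : ℤ)
    (hm : ∀ n : ℕ, m ≠ (2 * d + 1) * n + s) : (hser d s p).coeff m = 0 := by
  rw [hser, HahnSeries.coeff_single_mul, one_mul]
  by_cases h : m - s < 0
  · exact ofPowerSeries_coeff_neg _ h
  · obtain ⟨j, hj⟩ := Int.eq_ofNat_of_zero_le (not_lt.1 h)
    rw [hj, HahnSeries.ofPowerSeries_apply_coeff, PowerSeries.coeff_expand_of_not_dvd]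
    rintro ⟨n, rfl⟩
    exact hm n (by push_cast at hj; linarith)

theorem hser_injective (d : ℕ) (s : ℤ) : Function.Injective (hser d s) := by
  intro p r h
  ext n
  rw [← coeff_hser d s, h, coeff_hser]

theorem hser_mul (d : ℕ) (s t : ℤ) (p r : PowerSeries ℂ) :
    hser d s p * hser d t r = hser d (s + t) (p * r) := by
  rw [hser, hser, hser, map_mul, map_mul,
    show (HahnSeries.single (s + t) 1 : InvSeries)
      = HahnSeries.single s 1 * HahnSeries.single t 1 by
        rw [HahnSeries.single_mul_single, one_mul]]
  ring

theorem hser_add (d : ℕ) (s : ℤ) (p r : PowerSeries ℂ) :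
    hser d s (p + r) = hser d s p + hser d s r := by
  rw [hser, hser, hser, map_add, map_add, mul_add]

theorem hser_sub (d : ℕ) (s : ℤ) (p r : PowerSeries ℂ) :
    hser d s (p - r) = hser d s p - hser d s r := by
  rw [hser, hser, hser, map_sub, map_sub, mul_sub]

theorem hser_zero (d : ℕ) (s : ℤ) : hser d s 0 = 0 := by
  rw [hser, map_zero, map_zero, mul_zero]

theorem hser_C (d : ℕ) (a : ℂ) : hser d 0 (PowerSeries.C a) = HahnSeries.C a := by
  rw [hser, PowerSeries.expand_C, HahnSeries.ofPowerSeries_C]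
  exact one_mul _

theorem C_mul_hser (d : ℕ) (a : ℂ) (s : ℤ) (p : PowerSeries ℂ) :
    HahnSeries.C a * hser d s p = hser d s (PowerSeries.C a * p) := by
  rw [← hser_C d, hser_mul, zero_add]

theorem hser_one (d : ℕ) : hser d 0 1 = 1 := by
  rw [← map_one PowerSeries.C, hser_C, map_one]

theorem hser_neg_one (d : ℕ) : hser d (-1) 1 = varX := by
  rw [hser, map_one (PowerSeries.expand (2 * d + 1) _), map_one (HahnSeries.ofPowerSeries ℤ ℂ),
    mul_one, varX]

theorem hser_X_mul (d : ℕ) (s : ℤ) (p : PowerSeries ℂ) :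
    hser d s (PowerSeries.X * p) = hser d (s + (2 * d + 1)) p := by
  rw [hser, hser, map_mul, map_mul, PowerSeries.expand_X, HahnSeries.ofPowerSeries_X_pow,
    ← mul_assoc, HahnSeries.single_mul_single, one_mul]
  push_cast
  rfl

theorem ansatz_eq_hser (d : ℕ) (v : ℕ → ℂ) : ansatz d v = -hser d 1 (PowerSeries.mk v) := by
  rw [ansatz, hser, map_neg, map_mul, HahnSeries.ofPowerSeries_X]

/-- The coefficients of the derivative of a homogeneous series. -/
def homDer (d : ℕ) (s : ℤ) (p : PowerSeries ℂ) : PowerSeries ℂ :=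
  PowerSeries.mk fun n => -((2 * d + 1) * n + s) * PowerSeries.coeff n p

theorem coeff_homDer (d : ℕ) (s : ℤ) (p : PowerSeries ℂ) (n : ℕ) :
    PowerSeries.coeff n (homDer d s p) = -((2 * d + 1) * n + s) * PowerSeries.coeff n p :=
  PowerSeries.coeff_mk _ _

theorem derX_hser (d : ℕ) (s : ℤ) (p : PowerSeries ℂ) :
    derX (hser d s p) = hser d (s + 1) (homDer d s p) := by
  ext m
  rw [derX_apply, coeff_dX]
  by_cases h : ∃ n : ℕ, m = (2 * d + 1) * n + (s + 1)
  · obtain ⟨n, rfl⟩ := h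
    rw [coeff_hser, show (2 * d + 1) * n + (s + 1) - 1 = (2 * d + 1) * n + s by ring, coeff_hser,
      coeff_homDer]
    push_cast
    ring
  · push Not at h
    rw [coeff_hser_of_ne _ _ _ _ h, coeff_hser_of_ne, mul_zero]
    intro n hn
    exact h n (by linarith)

/-- Only constants have zero derivative, and for s > 0 no exponent (2d+1)n + s vanishes. This fixes
the constants of integration in the Lenard recursion. -/
theorem hser_eq_zero_of_derX (d : ℕ) {s : ℤ} (hs : 0 < s) (p : PowerSeries ℂ)
    (h : derX (hser d s p) = 0) : hser d s p = 0 := by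
  rw [derX_hser, ← hser_zero d (s + 1)] at h
  have h0 : p = 0 := by
    ext n
    have hn := congrArg (PowerSeries.coeff n) (hser_injective _ _ h)
    rw [coeff_homDer, map_zero] at hn
    have hne : ((2 * d + 1) * n + s : ℂ) ≠ 0 := by
      have : ((2 * d + 1) * n + s : ℤ) ≠ 0 := by positivity
      exact_mod_cast this
    simpa [hne] using (mul_eq_zero.1 hn).resolve_left (neg_ne_zero.2 hne)
  rw [h0, hser_zero]

/-- A series of the form `∑ p_n X^{-((2d+1)n+s)}`. -/
def IsHom (d : ℕ) (s : ℤ) (F : InvSeries) : Prop := ∃ p, F = hser d s p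

namespace IsHom

variable {d : ℕ} {s t : ℤ} {F G : InvSeries}

theorem add (hF : IsHom d s F) (hG : IsHom d s G) : IsHom d s (F + G) := by
  obtain ⟨p, rfl⟩ := hF
  obtain ⟨r, rfl⟩ := hG
  exact ⟨_, (hser_add ..).symm⟩

theorem sub (hF : IsHom d s F) (hG : IsHom d s G) : IsHom d s (F - G) := by
  obtain ⟨p, rfl⟩ := hF
  obtain ⟨r, rfl⟩ := hG
  exact ⟨_, (hser_sub ..).symm⟩

theorem mul (hF : IsHom d s F) (hG : IsHom d t G) : IsHom d (s + t) (F * G) := by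
  obtain ⟨p, rfl⟩ := hF
  obtain ⟨r, rfl⟩ := hG
  exact ⟨_, hser_mul ..⟩

theorem C_mul (a : ℂ) (hF : IsHom d s F) : IsHom d s (HahnSeries.C a * F) := by
  obtain ⟨p, rfl⟩ := hF
  exact ⟨_, C_mul_hser ..⟩

theorem der (hF : IsHom d s F) : IsHom d (s + 1) (derX F) := by
  obtain ⟨p, rfl⟩ := hF
  exact ⟨_, derX_hser ..⟩

theorem sum {ι : Type*} (S : Finset ι) {f : ι → InvSeries} (h : ∀ i ∈ S, IsHom d s (f i)) :
    IsHom d s (∑ i ∈ S, f i) := by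
  classical
  induction S using Finset.induction_on with
  | empty => exact ⟨0, (hser_zero d s).symm⟩
  | insert i S hi ih =>
    rw [Finset.sum_insert hi]
    exact (h i (Finset.mem_insert_self _ _)).add
      (ih fun j hj => h j (Finset.mem_insert_of_mem hj))

theorem cast (hF : IsHom d s F) (h : s = t) : IsHom d t F := h ▸ hF

end IsHom

/-! ### The Lenard sequence of a potential -/

/-- The coefficients of the resolvent `b(λ)` evaluated at a potential `u`. -/
def resCoeff (u : InvSeries) (k : ℕ) : InvSeries := evalHom u (bCoeff k)

theorem resCoeff_zero (u : InvSeries) : resCoeff u 0 = 1 := by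
  rw [resCoeff, bCoeff, map_one]

theorem resCoeff_one (u : InvSeries) : resCoeff u 1 = u := by
  rw [resCoeff, bCoeff_one, evalHom_X, Function.iterate_zero_apply]

/-- The operator `∂³ + 8 u ∂ + 4 u'`. -/
def lenardOp (u f : InvSeries) : InvSeries :=
  derX (derX (derX f)) + 8 * u * derX f + 4 * derX u * f

theorem resCoeff_lenard (u : InvSeries) (k : ℕ) :
    4 * derX (resCoeff u (k + 1)) = lenardOp u (resCoeff u k) := by
  have h := congrArg (evalHom u) (lenard k)
  simp only [map_add, map_mul, map_ofNat, ← derX_evalHom, evalHom_X,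
    Function.iterate_zero_apply, Function.iterate_one, ← derX_apply] at h
  exact h

/-- The Lenard recursion gives only the derivative of the next coefficient, so the quadratic
recursion of `bCoeff` is used. It is homogeneous when u has weight 2 and ∂ has weight 1. -/
theorem resCoeff_isHom {d : ℕ} {u : InvSeries} (hu : IsHom d 2 u) (k : ℕ) :
    IsHom d (2 * k) (resCoeff u k) := by
  induction k using Nat.strong_induction_on with
  | _ k ih =>
    cases k with
    | zero => exact ⟨1, by rw [resCoeff_zero, ← hser_one d]; rfl⟩
    | succ k =>
      have h4 : (4 : InvSeries) = HahnSeries.C 4 := (map_ofNat HahnSeries.C 4).symm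
      have h2 : (2 : InvSeries) = HahnSeries.C 2 := (map_ofNat HahnSeries.C 2).symm
      have hr : ∀ i, resCoeff u i = evalHom u (bCoeff i) := fun _ => rfl
      rw [resCoeff, bCoeff_succ]
      simp only [map_add, map_mul, map_sub, map_sum, map_ofNat, ← derX_evalHom, evalHom_X,
        Function.iterate_zero_apply, evalHom_C, ← hr]
      refine ((IsHom.sum _ fun i hi => ?_).sub ?_).C_mul _
      · have hi := Finset.mem_range.1 hi
        have hA := ih i (by omega)
        have hB := ih (k - i) (by omega)
        have hk : ((k - i : ℕ) : ℤ) = k - i := by omega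
        refine IsHom.add (IsHom.sub ?_ ?_) ?_
        · exact (hA.mul hB.der.der).cast (by rw [hk]; push_cast; ring)
        · exact ((hA.der.mul hB.der).C_mul _).cast (by rw [hk]; push_cast; ring)
        · rw [h4]
          exact ((hu.C_mul 4).mul (hA.mul hB)).cast (by rw [hk]; push_cast; ring)
      · rw [h2]
        refine (IsHom.sum _ fun i hi => ?_).C_mul _
        have hi := Finset.mem_range.1 hi
        have hk : ((k - i : ℕ) : ℤ) = k - i := by omega
        exact ((ih (i + 1) (by omega)).mul (ih (k - i) (by omega))).cast
          (by rw [hk]; push_cast; ring)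

/-- The coefficient form of the Lenard recursion. -/
theorem lenard_coeff {d k : ℕ} {p c c' : PowerSeries ℂ}
    (h : 4 * derX (hser d (2 * (k + 1 : ℕ)) c') = lenardOp (hser d 2 p) (hser d (2 * k) c))
    (n : ℕ) :
    4 * ((2 * d + 1) * n + 2 * k + 2) * PowerSeries.coeff n c' =
      ((2 * d + 1) * n + 2 * k) * ((2 * d + 1) * n + 2 * k + 1) * ((2 * d + 1) * n + 2 * k + 2)
        * PowerSeries.coeff n c
      + ∑ x ∈ Finset.HasAntidiagonal.antidiagonal n,
          (8 * ((2 * d + 1) * x.2 + 2 * k) + 4 * ((2 * d + 1) * x.1 + 2))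
            * (PowerSeries.coeff x.1 p * PowerSeries.coeff x.2 c) := by
  have h4 : (4 : InvSeries) = HahnSeries.C 4 := (map_ofNat HahnSeries.C 4).symm
  have h8 : (8 : InvSeries) = HahnSeries.C 8 := (map_ofNat HahnSeries.C 8).symm
  rw [lenardOp, h4, h8] at h
  simp only [derX_hser, C_mul_hser, hser_mul] at h
  rw [show (2 * ((k + 1 : ℕ) : ℤ) + 1) = 2 * k + 3 by push_cast; ring,
    show (2 * (k : ℤ) + 1 + 1 + 1) = 2 * k + 3 by ring,
    show (2 + (2 * (k : ℤ) + 1)) = 2 * k + 3 by ring,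
    show (2 + 1 + 2 * (k : ℤ)) = 2 * k + 3 by ring, ← hser_add, ← hser_add] at h
  have hn := congrArg (PowerSeries.coeff n) (hser_injective _ _ h)
  simp only [map_add, PowerSeries.coeff_C_mul, mul_assoc] at hn
  simp only [coeff_homDer, PowerSeries.coeff_mul] at hn
  push_cast at hn
  have hs : ∑ x ∈ Finset.HasAntidiagonal.antidiagonal n,
          (8 * ((2 * d + 1) * (x.2 : ℂ) + 2 * k) + 4 * ((2 * d + 1) * x.1 + 2))
            * (PowerSeries.coeff x.1 p * PowerSeries.coeff x.2 c) =
      -(8 * ∑ x ∈ Finset.HasAntidiagonal.antidiagonal n, PowerSeries.coeff x.1 p *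
          (-((2 * d + 1) * (x.2 : ℂ) + 2 * k) * PowerSeries.coeff x.2 c)) -
      4 * ∑ x ∈ Finset.HasAntidiagonal.antidiagonal n,
        (-((2 * d + 1) * (x.1 : ℂ) + 2) * PowerSeries.coeff x.1 p) *
        PowerSeries.coeff x.2 c := by
    rw [Finset.mul_sum, Finset.mul_sum, ← Finset.sum_neg_distrib, ← Finset.sum_sub_distrib]
    exact Finset.sum_congr rfl fun x _ => by ring
  rw [hs]
  simp only [mul_assoc] at hn ⊢
  linear_combination -hn

/-! ### The merging identity -/

/-- The right side involves L f and L g only, so on a Lenard sequence L can be traded for an index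
shift. -/
theorem lenardOp_wronskian (u f g : InvSeries) :
    lenardOp u (f * derX g - derX f * g) =
      f * derX (lenardOp u g) + 2 * derX f * lenardOp u g
        - (g * derX (lenardOp u f) + 2 * derX g * lenardOp u f) := by
  simp only [lenardOp, map_add, map_sub, derX_mul, derX_four, derX_eight]
  ring

theorem lenardOp_add (u f g : InvSeries) :
    lenardOp u (f + g) = lenardOp u f + lenardOp u g := by
  simp only [lenardOp, map_add]; ring

theorem lenardOp_sub (u f g : InvSeries) :
    lenardOp u (f - g) = lenardOp u f - lenardOp u g := by
  simp only [lenardOp, map_sub]; ring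

theorem lenardOp_C_mul (u : InvSeries) (a : ℂ) (f : InvSeries) :
    lenardOp u (HahnSeries.C a * f) = HahnSeries.C a * lenardOp u f := by
  simp only [lenardOp, derX_C_mul]; ring

theorem lenardOp_zero (u : InvSeries) : lenardOp u 0 = 0 := by
  simp [lenardOp]

theorem lenardOp_sum (u : InvSeries) {ι : Type*} (S : Finset ι) (f : ι → InvSeries) :
    lenardOp u (∑ i ∈ S, f i) = ∑ i ∈ S, lenardOp u (f i) :=
  map_sum (AddMonoidHom.mk' (lenardOp u) (lenardOp_add u)) f S

/-- The commutator of L with the scaling field X∂: the 3 is the order of L, and 2u + X u' is the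
variation of u under scaling, which the similarity equation rewrites. -/
theorem lenardOp_varX_mul (u f : InvSeries) :
    lenardOp u (varX * derX f) = varX * derX (lenardOp u f) + 3 * lenardOp u f
      - 8 * (2 * u + varX * derX u) * derX f - 4 * derX (2 * u + varX * derX u) * f := by
  simp only [lenardOp, map_add, derX_mul, derX_varX, derX_two, derX_four, derX_eight,
    mul_zero, mul_one, add_zero]
  ring

/-- The similarity equation `4^d b_{d+1}' = 2u + X u'`. -/
def IsSimilar (d : ℕ) (u : InvSeries) : Prop :=
  HahnSeries.C (4 ^ d) * derX (resCoeff u (d + 1)) = 2 * u + varX * derX u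

/-- The Wronskian sum `∑_{j ≤ d} (b_j b_{k+d-j}' - b_j' b_{k+d-j})`. -/
def wronskianSum (d : ℕ) (u : InvSeries) (k : ℕ) : InvSeries :=
  ∑ j ∈ Finset.range (d + 1), (resCoeff u j * derX (resCoeff u (k + d - j))
    - derX (resCoeff u j) * resCoeff u (k + d - j))

theorem four_ne_zero_invSeries : (4 : InvSeries) ≠ 0 := by
  have h4 : (4 : InvSeries) = HahnSeries.C 4 := (map_ofNat HahnSeries.C 4).symm
  rw [h4]
  exact HahnSeries.C_ne_zero (by norm_num)

/-- Applying L to the j-th summand gives 4 times the derivative of the j-th summand for k + 1, plus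
4(H_j - H_{j+1}). The sum telescopes: H_0 = 0 because b_0 = 1, and H_{d+1} is the correction term.
-/
theorem lenardOp_wronskianSum (d : ℕ) (u : InvSeries) (k : ℕ) :
    lenardOp u (wronskianSum d u k) = 4 * derX (wronskianSum d u (k + 1))
      - 4 * (derX (derX (resCoeff u (d + 1))) * resCoeff u k
        + 2 * derX (resCoeff u (d + 1)) * derX (resCoeff u k)) := by
  set B := resCoeff u with hB
  have L : ∀ i, 4 * derX (B (i + 1)) = lenardOp u (B i) := resCoeff_lenard u
  set H : ℕ → InvSeries := fun j => derX (derX (B j)) * B (k + d + 1 - j)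
    + 2 * derX (B j) * derX (B (k + d + 1 - j)) with hH
  have key : ∀ j ∈ Finset.range (d + 1),
      lenardOp u (B j * derX (B (k + d - j)) - derX (B j) * B (k + d - j)) =
      4 * derX (B j * derX (B (k + 1 + d - j)) - derX (B j) * B (k + 1 + d - j))
        + 4 * (H j - H (j + 1)) := by
    intro j hj
    have hj := Finset.mem_range.1 hj
    rw [lenardOp_wronskian, ← L, ← L, show k + 1 + d - j = k + d - j + 1 by omega]
    simp only [hH]
    rw [show k + d + 1 - j = k + d - j + 1 by omega,
      show k + d + 1 - (j + 1) = k + d - j by omega]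
    simp only [map_sub, derX_mul, derX_four]
    ring
  have h0 : B 0 = 1 := resCoeff_zero u
  rw [wronskianSum, wronskianSum, lenardOp_sum, Finset.sum_congr rfl key, Finset.sum_add_distrib,
    map_sum, ← Finset.mul_sum, ← Finset.mul_sum,
    Finset.sum_range_sub']
  simp only [hH, h0, derX_one, map_zero, show k + d + 1 - (d + 1) = k by omega]
  ring

/-- The summand is antisymmetric under j ↦ d - j. -/
theorem wronskianSum_zero (d : ℕ) (u : InvSeries) : wronskianSum d u 0 = 0 := by
  rw [wronskianSum, Finset.sum_sub_distrib, sub_eq_zero, ← Finset.sum_range_reflect]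
  refine Finset.sum_congr rfl fun j hj => ?_
  have hj := Finset.mem_range.1 hj
  rw [show d + 1 - 1 - j = 0 + d - j by omega, show 0 + d - (0 + d - j) = j by omega, mul_comm]

theorem IsHom.of_add {d : ℕ} {s : ℤ} {F : InvSeries} (h : IsHom d (s + (2 * d + 1)) F) :
    IsHom d s F := by
  obtain ⟨p, rfl⟩ := h
  exact ⟨_, (hser_X_mul ..).symm⟩

theorem wronskianSum_isHom {d : ℕ} {u : InvSeries} (hu : IsHom d 2 u) (k : ℕ) :
    IsHom d (2 * k + (2 * d + 1)) (wronskianSum d u k) := by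
  refine IsHom.sum _ fun j hj => ?_
  have hj := Finset.mem_range.1 hj
  have hk : ((k + d - j : ℕ) : ℤ) = k + d - j := by omega
  have hA := resCoeff_isHom hu j
  have hB := resCoeff_isHom hu (k + d - j)
  exact ((hA.mul hB.der).cast (by rw [hk]; ring)).sub ((hA.der.mul hB).cast (by rw [hk]; ring))

/-- The merging identity `2k b_k + X b_k' = 4^d ∑_{j ≤ d} (b_j b_{k+d-j}' - b_j' b_{k+d-j})`. -/
theorem merging {d : ℕ} {u : InvSeries} (hu : IsHom d 2 u) (hs : IsSimilar d u) (k : ℕ) :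
    HahnSeries.C (2 * k : ℂ) * resCoeff u k + varX * derX (resCoeff u k) =
      HahnSeries.C (4 ^ d) * wronskianSum d u k := by
  have hv : IsHom d (-1) varX := ⟨1, (hser_neg_one d).symm⟩
  set T : ℕ → InvSeries := fun k => HahnSeries.C (2 * k : ℂ) * resCoeff u k
    + varX * derX (resCoeff u k) - HahnSeries.C (4 ^ d) * wronskianSum d u k with hT
  have hom : ∀ k : ℕ, IsHom d (2 * k) (T k) := fun k =>
    (((resCoeff_isHom hu k).C_mul _).add
      ((hv.mul (resCoeff_isHom hu k).der).cast (by ring))).sub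
      ((wronskianSum_isHom hu k).of_add.C_mul _)
  -- The differences T_k again obey the Lenard recursion: the commutator terms and the correction
  -- term of the Wronskian sum cancel by the similarity equation.
  have step : ∀ k, lenardOp u (T k) = 4 * derX (T (k + 1)) := by
    intro k
    have hd := congrArg derX hs
    rw [derX_C_mul] at hd
    have hc : HahnSeries.C (2 * (k + 1 : ℕ) : ℂ) = HahnSeries.C (2 * k : ℂ) + (2 : InvSeries) := by
      have h2 : (2 : InvSeries) = HahnSeries.C 2 := (map_ofNat HahnSeries.C 2).symm
      rw [h2, ← map_add]; push_cast; ring_nf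
    simp only [hT]
    rw [lenardOp_sub, lenardOp_add, lenardOp_C_mul, lenardOp_C_mul, lenardOp_varX_mul,
      lenardOp_wronskianSum, ← resCoeff_lenard, ← hd, map_sub, map_add, derX_C_mul, derX_C_mul,
      derX_mul varX, derX_mul 4, derX_four, derX_varX, hc]
    unfold IsSimilar at hs
    linear_combination 8 * derX (resCoeff u k) * hs
  -- T_0 = 0, and T_k = 0 makes T_{k+1} a series of positive weight with zero derivative.
  have zero : ∀ k, T k = 0 := by
    intro k
    induction k with
    | zero =>
      simp [hT, resCoeff_zero, wronskianSum_zero, derX_one]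
    | succ k ih =>
      have h := step k
      rw [ih, lenardOp_zero] at h
      have h' := (mul_eq_zero.1 h.symm).resolve_left four_ne_zero_invSeries
      obtain ⟨p, hp⟩ := hom (k + 1)
      rw [hp] at h' ⊢
      exact hser_eq_zero_of_derX d (by positivity) p h'
  exact sub_eq_zero.1 (zero k)

/-! ### The coefficient array -/

/-- The array of coefficients `b_k = ∑ β_{k,n} X^{-((2d+1)n+2k)}` of the Lenard sequence of the
similarity solution. -/
def coeffArray (d : ℕ) : ℕ → ℕ → ℝ
  | 0, 0 => 1
  | 0, _ + 1 => 0
  | 1, 0 => 1 / 8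
  | 1, n + 1 => 4 ^ d * ((2 * d + 1) * n + 2 * d + 2) * coeffArray d (d + 1) n
      / ((2 * d + 1) * (n + 1))
  | k + 2, n =>
    (((2 * d + 1) * n + 2 * (k + 1)) * ((2 * d + 1) * n + 2 * (k + 1) + 1)
        * ((2 * d + 1) * n + 2 * (k + 1) + 2) * coeffArray d (k + 1) n
      + ∑ i : Fin (n + 1),
        (8 * ((2 * d + 1) * (n - i : ℕ) + 2 * (k + 1)) + 4 * ((2 * d + 1) * i + 2))
          * (coeffArray d 1 i * coeffArray d (k + 1) (n - i)))
      / (4 * ((2 * d + 1) * n + 2 * (k + 1) + 2))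
-- The similarity equation produces β_{1,n+1} from β_{d+1,n}. The Lenard recursion uses smaller n,
-- or the same n with smaller k.
termination_by k n => (n, k)
decreasing_by
  · exact Prod.Lex.left _ _ (Nat.lt_succ_self _)
  · exact Prod.Lex.right _ (Nat.lt_succ_self _)
  · rcases (Nat.lt_succ_iff.1 i.2).lt_or_eq with h | h
    · exact Prod.Lex.left _ _ h
    · rw [h]; exact Prod.Lex.right _ (by omega)
  · rcases (Nat.sub_le n i).lt_or_eq with h | h
    · exact Prod.Lex.left _ _ h
    · rw [h]; exact Prod.Lex.right _ (by omega)

theorem coeffArray_zero (d n : ℕ) : coeffArray d 0 n = if n = 0 then 1 else 0 := by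
  cases n <;> simp [coeffArray]

theorem coeffArray_one_zero (d : ℕ) : coeffArray d 1 0 = 1 / 8 := by rw [coeffArray]

theorem coeffArray_one_succ (d n : ℕ) : (2 * d + 1) * (n + 1) * coeffArray d 1 (n + 1) =
    4 ^ d * ((2 * d + 1) * n + 2 * d + 2) * coeffArray d (d + 1) n := by
  rw [coeffArray]
  field_simp

theorem coeffArray_succ (d k n : ℕ) :
    4 * ((2 * d + 1) * n + 2 * k + 2) * coeffArray d (k + 1) n =
      ((2 * d + 1) * n + 2 * k) * ((2 * d + 1) * n + 2 * k + 1) * ((2 * d + 1) * n + 2 * k + 2)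
        * coeffArray d k n
      + ∑ x ∈ Finset.HasAntidiagonal.antidiagonal n,
          (8 * ((2 * d + 1) * x.2 + 2 * k) + 4 * ((2 * d + 1) * x.1 + 2))
            * (coeffArray d 1 x.1 * coeffArray d k x.2) := by
  cases k with
  | zero =>
    rw [Finset.sum_eq_single (n, 0)]
    · rw [coeffArray_zero, coeffArray_zero]
      rcases eq_or_ne n 0 with rfl | h
      · simp
      · simp [h]
    · rintro ⟨i, j⟩ hx hne
      have h : i + j = n := Finset.HasAntidiagonal.mem_antidiagonal.1 hx
      have : j ≠ 0 := by rintro rfl; exact hne (by simp at h; simp [h])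
      simp [coeffArray_zero, this]
    · simp
  | succ k =>
    rw [Finset.Nat.sum_antidiagonal_eq_sum_range_succ_mk, Finset.sum_range, coeffArray]
    have : (4 * ((2 * d + 1) * n + 2 * (k + 1) + 2) : ℝ) ≠ 0 := by positivity
    push_cast
    rw [mul_div_cancel₀ _ this]

/-- The coefficients of every b_k up to index N depend only on those of u up to N. The truncated
form is what the induction in `eq_potential_of_isSimilar` needs: there the similarity equation then
yields coefficient N + 1 of u. -/
theorem coeff_eq_coeffArray_of_le {d N : ℕ} {c : ℕ → PowerSeries ℂ} (h0 : c 0 = 1)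
    (h1 : ∀ n ≤ N, PowerSeries.coeff n (c 1) = coeffArray d 1 n)
    (hrec : ∀ k n : ℕ, 4 * ((2 * d + 1) * n + 2 * k + 2) * PowerSeries.coeff n (c (k + 1)) =
      ((2 * d + 1) * n + 2 * k) * ((2 * d + 1) * n + 2 * k + 1) * ((2 * d + 1) * n + 2 * k + 2)
        * PowerSeries.coeff n (c k)
      + ∑ x ∈ Finset.HasAntidiagonal.antidiagonal n,
          (8 * ((2 * d + 1) * x.2 + 2 * k) + 4 * ((2 * d + 1) * x.1 + 2))
            * (PowerSeries.coeff x.1 (c 1) * PowerSeries.coeff x.2 (c k)))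
    (k n : ℕ) (hn : n ≤ N) : PowerSeries.coeff n (c k) = coeffArray d k n := by
  induction k generalizing n with
  | zero =>
    rw [h0, coeffArray_zero, PowerSeries.coeff_one]
    split_ifs <;> simp
  | succ k ih =>
    have hne : (4 * ((2 * d + 1) * n + 2 * k + 2) : ℂ) ≠ 0 := by
      have : (4 * ((2 * d + 1) * n + 2 * k + 2) : ℕ) ≠ 0 := by positivity
      exact_mod_cast this
    apply mul_left_cancel₀ hne
    have h := congrArg (Complex.ofReal) (coeffArray_succ d k n)
    push_cast at h
    rw [hrec, h, ih n hn]
    congr 1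
    refine Finset.sum_congr rfl fun x hx => ?_
    have hx : x.1 + x.2 = n := Finset.HasAntidiagonal.mem_antidiagonal.1 hx
    rw [h1 _ (by omega), ih _ (by omega)]

/-- The similarity equation in terms of coefficients. -/
theorem isSimilar_iff {d : ℕ} {p c : PowerSeries ℂ}
    (hc : resCoeff (hser d 2 p) (d + 1) = hser d (2 * (d + 1 : ℕ)) c) :
    IsSimilar d (hser d 2 p) ↔ ∀ n : ℕ, (2 * d + 1) * (n + 1) * PowerSeries.coeff (n + 1) p =
      4 ^ d * ((2 * d + 1) * n + 2 * d + 2) * PowerSeries.coeff n c := by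
  have h2 : (2 : InvSeries) = HahnSeries.C 2 := (map_ofNat HahnSeries.C 2).symm
  -- The coefficient at 0 cancels, so the similarity equation leaves the leading coefficient of u
  -- free.
  have hp : PowerSeries.C 2 * p + homDer d 2 p =
      PowerSeries.X * PowerSeries.mk fun n : ℕ =>
        -((2 * d + 1) * (n + 1) * PowerSeries.coeff (n + 1) p) := by
    ext n
    rw [map_add, PowerSeries.coeff_C_mul, coeff_homDer]
    cases n with
    | zero => simp
    | succ n =>
      rw [PowerSeries.coeff_succ_X_mul, PowerSeries.coeff_mk]
      push_cast
      ring
  rw [IsSimilar, hc, derX_hser, derX_hser, ← hser_neg_one d, C_mul_hser, hser_mul, h2, C_mul_hser,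
    show (-1 + (2 + 1) : ℤ) = 2 by ring, one_mul, ← hser_add, hp, hser_X_mul,
    show (2 * (d + 1 : ℕ) + 1 : ℤ) = 2 + (2 * d + 1) by push_cast; ring,
    (hser_injective d _).eq_iff, PowerSeries.ext_iff]
  refine forall_congr' fun n => ?_
  rw [PowerSeries.coeff_C_mul, coeff_homDer, PowerSeries.coeff_mk]
  push_cast
  constructor <;> intro h
  · linear_combination h
  · linear_combination h

/-! ### The similarity solution -/

/-- The `k`-th row of the coefficient array as a power series. -/
def rowSeries (d k : ℕ) : PowerSeries ℂ := PowerSeries.mk fun n => (coeffArray d k n : ℂ)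

theorem coeff_rowSeries (d k n : ℕ) :
    PowerSeries.coeff n (rowSeries d k) = (coeffArray d k n : ℂ) := PowerSeries.coeff_mk _ _

/-- The potential `u = ∑ β_{1,n} X^{-((2d+1)n+2)}`. -/
def potential (d : ℕ) : InvSeries := hser d 2 (rowSeries d 1)

theorem exists_rows (d : ℕ) (p : PowerSeries ℂ) : ∃ c : ℕ → PowerSeries ℂ, c 0 = 1 ∧ c 1 = p ∧
    (∀ k, resCoeff (hser d 2 p) k = hser d (2 * k) (c k)) ∧
    ∀ k n : ℕ, 4 * ((2 * d + 1) * n + 2 * k + 2) * PowerSeries.coeff n (c (k + 1)) =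
      ((2 * d + 1) * n + 2 * k) * ((2 * d + 1) * n + 2 * k + 1) * ((2 * d + 1) * n + 2 * k + 2)
        * PowerSeries.coeff n (c k)
      + ∑ x ∈ Finset.HasAntidiagonal.antidiagonal n,
          (8 * ((2 * d + 1) * x.2 + 2 * k) + 4 * ((2 * d + 1) * x.1 + 2))
            * (PowerSeries.coeff x.1 (c 1) * PowerSeries.coeff x.2 (c k)) := by
  choose c hc using fun k => resCoeff_isHom (d := d) ⟨p, rfl⟩ k
  have h0 : c 0 = 1 := hser_injective d 0 (by
    rw [hser_one, ← resCoeff_zero (hser d 2 p), hc 0]; rfl)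
  have h1 : c 1 = p := hser_injective d 2 (by
    have := hc 1
    rw [resCoeff_one] at this
    exact this.symm)
  refine ⟨c, h0, h1, hc, fun k n => ?_⟩
  rw [h1]
  refine lenard_coeff ?_ n
  rw [← hc, ← hc, resCoeff_lenard]

theorem resCoeff_potential (d k : ℕ) :
    resCoeff (potential d) k = hser d (2 * k) (rowSeries d k) := by
  obtain ⟨c, h0, h1, hc, hrec⟩ := exists_rows d (rowSeries d 1)
  rw [potential, hc]
  congr 1
  ext n
  rw [coeff_rowSeries]
  exact coeff_eq_coeffArray_of_le h0 (fun i _ => by rw [h1, coeff_rowSeries]) hrec k n le_rfl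

theorem isSimilar_potential (d : ℕ) : IsSimilar d (potential d) := by
  rw [potential, isSimilar_iff (c := rowSeries d (d + 1)) (resCoeff_potential d (d + 1))]
  intro n
  rw [coeff_rowSeries, coeff_rowSeries]
  exact_mod_cast congrArg Complex.ofReal (coeffArray_one_succ d n)

theorem eq_potential_of_isSimilar {d : ℕ} {p : PowerSeries ℂ}
    (h0 : PowerSeries.coeff 0 p = 1 / 8) (hs : IsSimilar d (hser d 2 p)) :
    hser d 2 p = potential d := by
  obtain ⟨c, hc0, hc1, hc, hrec⟩ := exists_rows d p
  have hs' := (isSimilar_iff (hc (d + 1))).1 hs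
  have key : ∀ N, ∀ n ≤ N, PowerSeries.coeff n (c 1) = (coeffArray d 1 n : ℂ) := by
    intro N
    induction N with
    | zero =>
      intro n hn
      rw [Nat.le_zero.1 hn, hc1, h0, coeffArray_one_zero]
      push_cast
      rfl
    | succ N ih =>
      intro n hn
      rcases hn.lt_or_eq with h | rfl
      · exact ih n (by omega)
      · have hne : ((2 * d + 1) * (N + 1) : ℂ) ≠ 0 := by
          have : ((2 * d + 1) * (N + 1) : ℕ) ≠ 0 := by positivity
          exact_mod_cast this
        apply mul_left_cancel₀ hne
        rw [hc1, hs', coeff_eq_coeffArray_of_le hc0 ih hrec (d + 1) N le_rfl]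
        exact_mod_cast (congrArg Complex.ofReal (coeffArray_one_succ d N)).symm
  rw [potential]
  congr 1
  ext n
  rw [coeff_rowSeries, ← key n n le_rfl, hc1]

/-- The merging identity in terms of coefficients. -/
theorem coeffArray_merging (d k n : ℕ) : (2 * d + 1) * (n + 1) * coeffArray d k (n + 1) =
    4 ^ d * ∑ j ∈ Finset.range (d + 1), ∑ x ∈ Finset.HasAntidiagonal.antidiagonal n,
      (((2 * d + 1) * x.2 + 2 * (k + d - j : ℕ)) - ((2 * d + 1) * x.1 + 2 * j))
        * (coeffArray d j x.1 * coeffArray d (k + d - j) x.2) := by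
  have hm := merging (u := potential d) ⟨rowSeries d 1, rfl⟩ (isSimilar_potential d) k
  have hterm : ∀ j ∈ Finset.range (d + 1),
      resCoeff (potential d) j * derX (resCoeff (potential d) (k + d - j))
        - derX (resCoeff (potential d) j) * resCoeff (potential d) (k + d - j) =
      hser d (2 * k + (2 * d + 1))
        (rowSeries d j * homDer d (2 * (k + d - j : ℕ)) (rowSeries d (k + d - j))
          - homDer d (2 * j) (rowSeries d j) * rowSeries d (k + d - j)) := by
    intro j hj
    have hj := Finset.mem_range.1 hj
    have hk : ((k + d - j : ℕ) : ℤ) = k + d - j := by omega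
    rw [resCoeff_potential, resCoeff_potential, derX_hser, derX_hser, hser_mul, hser_mul, hser_sub]
    congr 2 <;> rw [hk] <;> ring
  have hsum : ∀ (s : ℤ) (S : Finset ℕ) (f : ℕ → PowerSeries ℂ),
      ∑ j ∈ S, hser d s (f j) = hser d s (∑ j ∈ S, f j) := fun s S f =>
    (map_sum (AddMonoidHom.mk' (hser d s) (hser_add d s)) f S).symm
  rw [wronskianSum, Finset.sum_congr rfl hterm, hsum, C_mul_hser, ← hser_X_mul,
    resCoeff_potential, derX_hser, C_mul_hser, ← hser_neg_one d, hser_mul, one_mul,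
    show (-1 + (2 * (k : ℤ) + 1)) = 2 * k by ring, ← hser_add] at hm
  have hn := congrArg (PowerSeries.coeff (n + 1)) (hser_injective _ _ hm)
  rw [PowerSeries.coeff_succ_X_mul, map_add, PowerSeries.coeff_C_mul, PowerSeries.coeff_C_mul,
    coeff_homDer, map_sum] at hn
  simp only [map_sub, PowerSeries.coeff_mul, coeff_homDer, coeff_rowSeries] at hn
  have hcast : (((2 * d + 1) * (n + 1) * coeffArray d k (n + 1) : ℝ) : ℂ) =
    ((4 ^ d * ∑ j ∈ Finset.range (d + 1), ∑ x ∈ Finset.HasAntidiagonal.antidiagonal n,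
      (((2 * d + 1) * x.2 + 2 * (k + d - j : ℕ)) - ((2 * d + 1) * x.1 + 2 * j))
        * (coeffArray d j x.1 * coeffArray d (k + d - j) x.2) : ℝ) : ℂ) := by
    have hrhs : ∑ j ∈ Finset.range (d + 1), ∑ x ∈ Finset.HasAntidiagonal.antidiagonal n,
        (((2 * d + 1) * (x.2 : ℂ) + 2 * (k + d - j : ℕ)) - ((2 * d + 1) * x.1 + 2 * j))
          * (coeffArray d j x.1 * coeffArray d (k + d - j) x.2) =
        -∑ j ∈ Finset.range (d + 1), (∑ x ∈ Finset.HasAntidiagonal.antidiagonal n,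
          (coeffArray d j x.1 : ℂ) * (-((2 * d + 1) * x.2 + (2 * (k + d - j : ℕ) : ℤ))
            * (coeffArray d (k + d - j) x.2 : ℂ)) -
          ∑ x ∈ Finset.HasAntidiagonal.antidiagonal n, -((2 * d + 1) * (x.1 : ℂ) + (2 * j : ℤ))
            * (coeffArray d j x.1 : ℂ) * (coeffArray d (k + d - j) x.2 : ℂ)) := by
      rw [← Finset.sum_neg_distrib]
      refine Finset.sum_congr rfl fun j _ => ?_
      rw [← Finset.sum_sub_distrib, ← Finset.sum_neg_distrib]
      refine Finset.sum_congr rfl fun x _ => ?_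
      push_cast
      ring
    push_cast [-Nat.cast_sub]
    rw [hrhs]
    generalize (∑ j ∈ Finset.range (d + 1), _ : ℂ) = S at hn ⊢
    push_cast at hn
    linear_combination -hn
  exact_mod_cast hcast

/-! ### The formal solution -/

/-- The series `R = 2^{2d-1} b_d - X/2`. -/
def defect (d : ℕ) (u : InvSeries) : InvSeries :=
  HahnSeries.C (2 ^ (2 * d - 1)) * resCoeff u d - HahnSeries.C (1 / 2) * varX

/-- Exactly for α = 1/2 the terms -VX - α equal (∂_X + 2V)(-X/2); the double factorial cancels the
normalization of `m`. -/
theorem p2Lhs_half {d : ℕ} (hd : 1 ≤ d) (V : InvSeries) :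
    p2Lhs d (1 / 2) V =
      derX (defect d (HahnSeries.C (1 / 2) * (derX V - V ^ 2)))
        + 2 * V * defect d (HahnSeries.C (1 / 2) * (derX V - V ^ 2)) := by
  obtain ⟨d, rfl⟩ : ∃ e, d = e + 1 := ⟨d - 1, by omega⟩
  have hne : ((2 * d + 1)‼ : ℂ) ≠ 0 := by exact_mod_cast (Nat.doubleFactorial_pos _).ne'
  have h2 : (2 : InvSeries) * HahnSeries.C (1 / 2) = 1 := by
    rw [← map_ofNat HahnSeries.C 2, ← map_mul]; norm_num
  have hm : ∀ u : InvSeries, evalJet (m (d + 1 - 1)) u =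
      HahnSeries.C (1 / ((2 * d + 1)‼ : ℂ)) * resCoeff u (d + 1) := by
    intro u
    rw [← evalHom_apply, m, map_mul, evalHom_C, Nat.add_sub_cancel, resCoeff]
  have hc : HahnSeries.C ((2 : ℂ) ^ (2 * (d + 1) - 1) * ((2 * (d + 1) - 1)‼ : ℂ)) *
      HahnSeries.C (1 / ((2 * d + 1)‼ : ℂ)) =
      (HahnSeries.C (2 ^ (2 * (d + 1) - 1)) : InvSeries) := by
    rw [← map_mul, show 2 * (d + 1) - 1 = 2 * d + 1 by omega, mul_assoc, mul_one_div_cancel hne,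
      mul_one]
  rw [p2Lhs, defect]
  simp only [hm, ← derX_apply, map_sub, derX_C_mul, derX_varX]
  rw [← hc]
  linear_combination V * varX * h2

/-- Uses L X = 8u + 4X u' and 4 · 2^{2d-1} = 2 · 4^d. Thus R lies in the kernel of L precisely when
u satisfies the similarity equation. -/
theorem lenardOp_defect {d : ℕ} (hd : 1 ≤ d) (u : InvSeries) :
    lenardOp u (defect d u) =
      2 * (HahnSeries.C (4 ^ d) * derX (resCoeff u (d + 1)) - (2 * u + varX * derX u)) := by
  have h2 : (2 : InvSeries) * HahnSeries.C (1 / 2) = 1 := by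
    rw [← map_ofNat HahnSeries.C 2, ← map_mul]; norm_num
  have hc : 4 * HahnSeries.C (2 ^ (2 * d - 1)) = 2 * (HahnSeries.C (4 ^ d) : InvSeries) := by
    rw [← map_ofNat HahnSeries.C 2, ← map_ofNat HahnSeries.C 4, ← map_mul, ← map_mul]
    congr 1
    obtain ⟨d, rfl⟩ : ∃ e, d = e + 1 := ⟨d - 1, by omega⟩
    rw [show (4 : ℂ) = 2 ^ 2 by norm_num, ← pow_mul, ← pow_add, ← pow_succ']
    congr 1
    omega
  rw [defect, lenardOp_sub, lenardOp_C_mul, lenardOp_C_mul, ← resCoeff_lenard]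
  have hX : lenardOp u varX = 8 * u + 4 * derX u * varX := by
    simp only [lenardOp, derX_varX, derX_one, map_zero]; ring
  rw [hX]
  linear_combination derX (resCoeff u (d + 1)) * hc - (4 * u + 2 * derX u * varX) * h2

theorem derX_derX_of_eq {V R : InvSeries} (h : derX R = -(2 * V * R)) :
    derX (derX R) = -(2 * (V * derX R + R * derX V)) := by
  have hder := congrArg derX h
  rwa [map_neg, mul_assoc, derX_mul, derX_mul, derX_two, mul_zero, add_zero] at hder

/-- If `R' = -2VR` then `R` is in the kernel of the Lenard operator of `u = (V' - V²)/2`. -/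
theorem lenardOp_eq_zero {V R : InvSeries} (h : derX R + 2 * V * R = 0) :
    lenardOp (HahnSeries.C (1 / 2) * (derX V - V ^ 2)) R = 0 := by
  have h2 : (2 : InvSeries) * HahnSeries.C (1 / 2) = 1 := by
    rw [← map_ofNat HahnSeries.C 2, ← map_mul]; norm_num
  -- Formally R = ψ² with ψ' = -Vψ, so ψ'' = -2uψ, and L is the symmetric square of ∂² + 2u. The
  -- computation verifies this without ψ.
  have h1 : derX R = -(2 * V * R) := eq_neg_of_add_eq_zero_left h
  have hR2 := derX_derX_of_eq h1
  have hR3 : derX (derX (derX R)) = -(2 * (V * derX (derX R) + 2 * derX R * derX V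
      + R * derX (derX V))) := by
    rw [hR2, map_neg, derX_mul, derX_two, map_add, derX_mul, derX_mul, hR2]; ring
  have hu : derX (HahnSeries.C (1 / 2) * (derX V - V ^ 2)) =
      HahnSeries.C (1 / 2) * (derX (derX V) - 2 * V * derX V) := by
    rw [derX_C_mul, map_sub, sq, derX_mul]; ring
  rw [lenardOp, hR3, hR2, hu, h1]
  linear_combination (-8 * (derX V - V ^ 2) * V * R
    + 2 * (derX (derX V) - 2 * V * derX V) * R) * h2

/-- The power series `1 - 4^d y ∑ β_{d,n} y^n`, which is `R` up to normalization. -/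
def defectSeries (d : ℕ) : PowerSeries ℂ :=
  1 - PowerSeries.X * (PowerSeries.C (4 ^ d) * rowSeries d d)

theorem coeff_zero_defectSeries (d : ℕ) : PowerSeries.coeff 0 (defectSeries d) = 1 := by
  simp [defectSeries]

theorem coeff_succ_defectSeries (d n : ℕ) :
    PowerSeries.coeff (n + 1) (defectSeries d) = -(4 ^ d * coeffArray d d n : ℝ) := by
  rw [defectSeries, map_sub, PowerSeries.coeff_succ_X_mul, PowerSeries.coeff_C_mul, coeff_rowSeries,
    PowerSeries.coeff_one, if_neg (Nat.succ_ne_zero n)]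
  push_cast
  ring

theorem defect_potential {d : ℕ} (hd : 1 ≤ d) :
    defect d (potential d) = HahnSeries.C (-1 / 2) * hser d (-1) (defectSeries d) := by
  have hc : HahnSeries.C (2 ^ (2 * d - 1)) =
      -(HahnSeries.C (-1 / 2) * (HahnSeries.C (4 ^ d) : InvSeries)) := by
    rw [← map_mul, ← map_neg]
    congr 1
    obtain ⟨d, rfl⟩ : ∃ e, d = e + 1 := ⟨d - 1, by omega⟩
    rw [show (4 : ℂ) = 2 ^ 2 by norm_num, ← pow_mul, show 2 * (d + 1) - 1 = 2 * d + 1 by omega,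
      show 2 * (d + 1) = 2 * d + 1 + 1 by ring, pow_succ _ (2 * d + 1)]
    ring
  have hn : HahnSeries.C (1 / 2) = -(HahnSeries.C (-1 / 2) : InvSeries) := by
    rw [← map_neg]; congr 1; norm_num
  rw [defect, defectSeries, hser_sub, hser_X_mul, hser_neg_one, ← C_mul_hser, resCoeff_potential,
    show (-1 + (2 * d + 1) : ℤ) = 2 * d by ring, hc, hn]
  ring

/-- The coefficients of the formal solution: `V R = -R'/2`. -/
def solSeries (d : ℕ) : PowerSeries ℂ :=
  PowerSeries.C (1 / 2) * homDer d (-1) (defectSeries d) * (defectSeries d)⁻¹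

theorem constantCoeff_defectSeries (d : ℕ) :
    PowerSeries.constantCoeff (defectSeries d) ≠ 0 := by
  rw [← PowerSeries.coeff_zero_eq_constantCoeff_apply, coeff_zero_defectSeries]
  exact one_ne_zero

theorem solSeries_mul (d : ℕ) : solSeries d * defectSeries d =
    PowerSeries.C (1 / 2) * homDer d (-1) (defectSeries d) := by
  rw [solSeries, mul_assoc, PowerSeries.inv_mul_cancel _ (constantCoeff_defectSeries d), mul_one]

theorem coeff_zero_solSeries (d : ℕ) : PowerSeries.coeff 0 (solSeries d) = 1 / 2 := by
  have h := congrArg (PowerSeries.coeff 0) (solSeries_mul d)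
  rw [PowerSeries.coeff_C_mul, coeff_homDer, PowerSeries.coeff_mul] at h
  simpa [coeff_zero_defectSeries, constantCoeff_defectSeries] using h

/-- With R known, R' + 2VR = 0 is linear in V. As `defectSeries` is invertible, `solSeries` is its
only solution. -/
theorem der_add_ansatz_iff (d : ℕ) (w : ℕ → ℂ) :
    derX (HahnSeries.C (-1 / 2) * hser d (-1) (defectSeries d))
      + 2 * ansatz d w * (HahnSeries.C (-1 / 2) * hser d (-1) (defectSeries d)) = 0 ↔
    PowerSeries.mk w * defectSeries d =
      PowerSeries.C (1 / 2) * homDer d (-1) (defectSeries d) := by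
  have h2 : (2 : InvSeries) * HahnSeries.C (-1 / 2) = -1 := by
    rw [← map_ofNat HahnSeries.C 2, ← map_mul, ← map_one HahnSeries.C, ← map_neg]; norm_num
  have hn : HahnSeries.C (-1 / 2) = -(HahnSeries.C (1 / 2) : InvSeries) := by
    rw [← map_neg]; congr 1; norm_num
  have e : derX (HahnSeries.C (-1 / 2) * hser d (-1) (defectSeries d))
      + 2 * ansatz d w * (HahnSeries.C (-1 / 2) * hser d (-1) (defectSeries d)) =
      hser d 0 (PowerSeries.mk w * defectSeries d)
        - hser d 0 (PowerSeries.C (1 / 2) * homDer d (-1) (defectSeries d)) := by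
    rw [derX_C_mul, derX_hser, ansatz_eq_hser, ← C_mul_hser, ← sub_eq_zero,
      show hser d 0 (PowerSeries.mk w * defectSeries d) =
        hser d 1 (PowerSeries.mk w) * hser d (-1) (defectSeries d) by
          rw [hser_mul]; norm_num,
      show (-1 + 1 : ℤ) = 0 by norm_num]
    linear_combination hser d 0 (homDer d (-1) (defectSeries d)) * hn
      - hser d 1 (PowerSeries.mk w) * hser d (-1) (defectSeries d) * h2
  rw [e, sub_eq_zero, (hser_injective d 0).eq_iff]

/-- V starts with -1/(2X), so u starts with (1/2 - 1/4)/2 = 1/8 times X^{-2}. -/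
theorem potential_of_ansatz (d : ℕ) (w : ℕ → ℂ) (h0 : w 0 = 1 / 2) : ∃ p : PowerSeries ℂ,
    PowerSeries.coeff 0 p = 1 / 8 ∧
    HahnSeries.C (1 / 2) * (derX (ansatz d w) - ansatz d w ^ 2) = hser d 2 p := by
  refine ⟨PowerSeries.C (1 / 2) * (-homDer d 1 (PowerSeries.mk w)
    - PowerSeries.mk w * PowerSeries.mk w), ?_, ?_⟩
  · rw [PowerSeries.coeff_C_mul, map_sub, map_neg, coeff_homDer, PowerSeries.coeff_mul]
    simp [h0]
    norm_num
  · rw [ansatz_eq_hser, map_neg, derX_hser,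
      show (-hser d 1 (PowerSeries.mk w)) ^ 2 =
          hser d 1 (PowerSeries.mk w) * hser d 1 (PowerSeries.mk w)
        by ring, hser_mul, ← C_mul_hser, hser_sub,
      ← zero_sub (homDer _ _ _), hser_sub, hser_zero, zero_sub, show (1 + 1 : ℤ) = 2 by norm_num]

theorem solution_unique {d : ℕ} (hd : 1 ≤ d) {w : ℕ → ℂ} (hw : IsFormalSolution d w) :
    w = fun n => PowerSeries.coeff n (solSeries d) := by
  obtain ⟨h0, hw⟩ := hw
  obtain ⟨p, hp0, hp⟩ := potential_of_ansatz d w h0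
  rw [p2Lhs_half hd] at hw
  have hker := lenardOp_eq_zero hw
  rw [hp, lenardOp_defect hd, mul_eq_zero] at hker
  have h2 : (2 : InvSeries) ≠ 0 := by
    rw [← map_ofNat HahnSeries.C 2]; exact HahnSeries.C_ne_zero (by norm_num)
  have hpot := eq_potential_of_isSimilar hp0 (sub_eq_zero.1 (hker.resolve_left h2))
  rw [hp, hpot, defect_potential hd, der_add_ansatz_iff, ← solSeries_mul] at hw
  have hne : defectSeries d ≠ 0 := fun h => by
    have := constantCoeff_defectSeries d
    rw [h, map_zero] at this
    exact this rfl
  rw [← mul_right_cancel₀ hne hw]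
  funext n
  rw [PowerSeries.coeff_mk]

/-- `R R'' - R'²/2 + 4 u R² = 0` for the similarity solution. -/
theorem quadratic_defect {d : ℕ} (hd : 1 ≤ d) :
    2 * defect d (potential d) * derX (derX (defect d (potential d)))
      - derX (defect d (potential d)) ^ 2
      + 8 * potential d * defect d (potential d) ^ 2 = 0 := by
  set R := defect d (potential d) with hR
  set u := potential d with hu
  have hker : lenardOp u R = 0 := by
    rw [hR, lenardOp_defect hd, sub_eq_zero.2 (isSimilar_potential d), mul_zero]
  -- The derivative of this expression is 2R · L R.
  have hder : derX (2 * R * derX (derX R) - derX R ^ 2 + 8 * u * R ^ 2) = 0 := by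
    rw [lenardOp] at hker
    simp only [sq, map_add, map_sub, derX_mul, derX_two, derX_eight]
    linear_combination 2 * R * hker
  have h2 : (2 : InvSeries) = HahnSeries.C 2 := (map_ofNat HahnSeries.C 2).symm
  have h8 : (8 : InvSeries) = HahnSeries.C 8 := (map_ofNat HahnSeries.C 8).symm
  have hform : 2 * R * derX (derX R) - derX R ^ 2 + 8 * u * R ^ 2 =
      hser d 0 (PowerSeries.C (1 / 2) * (defectSeries d *
          homDer d 0 (homDer d (-1) (defectSeries d)))
        - PowerSeries.C (1 / 4) * (homDer d (-1) (defectSeries d) * homDer d (-1) (defectSeries d))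
        + PowerSeries.C 2 * (rowSeries d 1 * (defectSeries d * defectSeries d))) := by
    have hC : (HahnSeries.C (-1 / 2) : InvSeries) * HahnSeries.C (-1 / 2)
        = HahnSeries.C (1 / 4) := by rw [← map_mul]; norm_num
    have hC2 : (HahnSeries.C 2 : InvSeries) * HahnSeries.C (1 / 4)
        = HahnSeries.C (1 / 2) := by rw [← map_mul]; norm_num
    have hC8 : (HahnSeries.C 8 : InvSeries) * HahnSeries.C (1 / 4)
        = HahnSeries.C 2 := by rw [← map_mul]; norm_num
    have e1 : hser d (-1) (defectSeries d) *
        hser d (-1 + 1 + 1) (homDer d (-1 + 1) (homDer d (-1) (defectSeries d))) =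
        hser d 0 (defectSeries d * homDer d 0 (homDer d (-1) (defectSeries d))) := by
      rw [hser_mul]; norm_num
    have e2 : hser d (-1 + 1) (homDer d (-1) (defectSeries d)) *
        hser d (-1 + 1) (homDer d (-1) (defectSeries d)) =
        hser d 0 (homDer d (-1) (defectSeries d) * homDer d (-1) (defectSeries d)) := by
      rw [hser_mul]; norm_num
    have e3 : hser d 2 (rowSeries d 1) *
        (hser d (-1) (defectSeries d) * hser d (-1) (defectSeries d)) =
        hser d 0 (rowSeries d 1 * (defectSeries d * defectSeries d)) := by
      rw [hser_mul, hser_mul]; norm_num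
    rw [hser_add, hser_sub, ← C_mul_hser, ← C_mul_hser, ← C_mul_hser, ← e1, ← e2, ← e3, ← hC8,
      ← hC2, ← hC, hR, hu, defect_potential hd, derX_C_mul, derX_hser, derX_C_mul, derX_hser,
      potential, h2, h8]
    ring
  rw [hform] at hder ⊢
  generalize hq : (PowerSeries.C (1 / 2) * (defectSeries d *
          homDer d 0 (homDer d (-1) (defectSeries d)))
        - PowerSeries.C (1 / 4) * (homDer d (-1) (defectSeries d) * homDer d (-1) (defectSeries d))
        + PowerSeries.C 2 * (rowSeries d 1 * (defectSeries d * defectSeries d)) :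
          PowerSeries ℂ) = Q at hder ⊢
  -- The expression has weight 0, so zero derivative leaves only its constant term. With R ~ -X/2
  -- and u ~ X^{-2}/8 that term is -1/4 + 8 · (1/8) · (1/4) = 0.
  have hQ : Q = 0 := by
    ext n
    cases n with
    | zero =>
      have hz : ∀ f g : PowerSeries ℂ, PowerSeries.coeff 0 (f * g) =
          PowerSeries.coeff 0 f * PowerSeries.coeff 0 g := fun f g => by
        simp [PowerSeries.coeff_mul]
      rw [← hq]
      simp only [map_add, map_sub, hz,
        coeff_homDer, coeff_zero_defectSeries, coeff_rowSeries, coeffArray_one_zero]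
      push_cast
      norm_num
    | succ n =>
      rw [derX_hser, ← hser_zero d (0 + 1)] at hder
      have hn := congrArg (PowerSeries.coeff (n + 1)) (hser_injective _ _ hder)
      rw [coeff_homDer, map_zero] at hn
      have hne : ((2 * d + 1) * (n + 1 : ℕ) + (0 : ℤ) : ℂ) ≠ 0 := by
        have : ((2 * d + 1) * (n + 1) : ℕ) ≠ 0 := by positivity
        push_cast
        rw [add_zero]
        exact_mod_cast this
      rw [(mul_eq_zero.1 hn).resolve_left (neg_ne_zero.2 hne), map_zero]
  rw [hQ, hser_zero]

theorem solution_exists {d : ℕ} (hd : 1 ≤ d) :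
    IsFormalSolution d fun n => PowerSeries.coeff n (solSeries d) := by
  refine ⟨coeff_zero_solSeries d, ?_⟩
  set w : ℕ → ℂ := fun n => PowerSeries.coeff n (solSeries d) with hw
  have hmk : PowerSeries.mk w = solSeries d := by ext n; rw [PowerSeries.coeff_mk]
  have hV := (der_add_ansatz_iff d w).2 (by rw [hmk, solSeries_mul])
  rw [← defect_potential hd] at hV
  set V := ansatz d w
  have hquad := quadratic_defect hd
  have hR0 : defect d (potential d) ≠ 0 := by
    rw [defect_potential hd]
    refine mul_ne_zero (HahnSeries.C_ne_zero (by norm_num)) fun h => ?_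
    rw [← hser_zero d (-1)] at h
    have := coeff_zero_defectSeries d
    rw [hser_injective _ _ h, map_zero] at this
    exact zero_ne_one this
  -- Inserting R' = -2VR into the first integral gives R² (8u - 4(V' - V²)) = 0, and R ≠ 0.
  have hu : HahnSeries.C (1 / 2) * (derX V - V ^ 2) = potential d := by
    generalize defect d (potential d) = R at hV hquad hR0
    generalize potential d = u at hquad ⊢
    have h2 : (2 : InvSeries) * HahnSeries.C (1 / 2) = 1 := by
      rw [← map_ofNat HahnSeries.C 2, ← map_mul]; norm_num
    have h8 : (8 : InvSeries) ≠ 0 := by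
      rw [← map_ofNat HahnSeries.C 8]; exact HahnSeries.C_ne_zero (by norm_num)
    have h1 : derX R = -(2 * V * R) := eq_neg_of_add_eq_zero_left hV
    have hR2 := derX_derX_of_eq h1
    rw [hR2, h1] at hquad
    apply mul_left_cancel₀ (mul_ne_zero h8 (pow_ne_zero 2 hR0))
    linear_combination 4 * R ^ 2 * (derX V - V ^ 2) * h2 - hquad
  rw [p2Lhs_half hd, hu]
  exact hV

/-- The recursion for the coefficients of the formal solution. -/
theorem solSeries_rec (d n : ℕ) : PowerSeries.coeff (n + 1) (solSeries d) =
    (((2 * d + 1) * (n + 1) - 1) / 2 + 1 / 2) * (4 ^ d * coeffArray d d n : ℝ)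
      + ∑ i ∈ Finset.range n, PowerSeries.coeff (i + 1) (solSeries d)
          * (4 ^ d * coeffArray d d (n - 1 - i) : ℝ) := by
  -- The term of the product with v_0 = 1/2 contributes the summand 1/2 in the leading factor. For n
  -- = 0 the remaining sum is empty, so the truncated n - 1 - i does no harm.
  have h := congrArg (PowerSeries.coeff (n + 1)) (solSeries_mul d)
  rw [PowerSeries.coeff_C_mul, coeff_homDer, PowerSeries.coeff_mul,
    Finset.Nat.sum_antidiagonal_eq_sum_range_succ_mk, Finset.sum_range_succ,
    Finset.sum_range_succ'] at h
  simp only [Nat.sub_self, coeff_zero_defectSeries, Nat.sub_zero, coeff_zero_solSeries,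
    coeff_succ_defectSeries] at h
  have hs : ∑ i ∈ Finset.range n, PowerSeries.coeff (i + 1) (solSeries d)
      * PowerSeries.coeff (n + 1 - (i + 1)) (defectSeries d) =
      -∑ i ∈ Finset.range n, PowerSeries.coeff (i + 1) (solSeries d)
          * (4 ^ d * coeffArray d d (n - 1 - i) : ℝ) := by
    rw [← Finset.sum_neg_distrib]
    refine Finset.sum_congr rfl fun i hi => ?_
    have hi := Finset.mem_range.1 hi
    rw [show n + 1 - (i + 1) = n - 1 - i + 1 by omega, coeff_succ_defectSeries]
    ring
  rw [hs] at h
  push_cast at h ⊢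
  linear_combination h

open Filter Topology

/-! ### Normalization -/

theorem coeffArray_nonneg (d k n : ℕ) : 0 ≤ coeffArray d k n := by
  induction n using Nat.strong_induction_on generalizing k with
  | _ n ihn =>
    induction k with
    | zero => rw [coeffArray_zero]; split_ifs <;> norm_num
    | succ k ihk =>
      have one : 0 ≤ coeffArray d 1 n := by
        cases n with
        | zero => rw [coeffArray_one_zero]; norm_num
        | succ n =>
          have h := coeffArray_one_succ d n
          have hpos : (0 : ℝ) < (2 * d + 1) * (n + 1) := by positivity
          refine nonneg_of_mul_nonneg_right (h ▸ ?_) hpos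
          have := ihn n (Nat.lt_succ_self n) (d + 1)
          positivity
      have h := coeffArray_succ d k n
      have hpos : (0 : ℝ) < 4 * ((2 * d + 1) * n + 2 * k + 2) := by positivity
      refine nonneg_of_mul_nonneg_right (h ▸ add_nonneg (by positivity) ?_) hpos
      refine Finset.sum_nonneg fun x hx => ?_
      have hx : x.1 + x.2 = n := Finset.HasAntidiagonal.mem_antidiagonal.1 hx
      have h1 : 0 ≤ coeffArray d 1 x.1 := by
        rcases (show x.1 ≤ n by omega).lt_or_eq with h | h
        · exact ihn _ h 1
        · rw [h]; exact one
      have h2 : 0 ≤ coeffArray d k x.2 := by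
        rcases (show x.2 ≤ n by omega).lt_or_eq with h | h
        · exact ihn _ h k
        · rw [h]; exact ihk
      positivity

/-- The coefficients divided by their expected size. -/
def normArray (d k n : ℕ) : ℝ :=
  coeffArray d k n * (4 ^ k * (2 * d + 1) ^ n * n !) / ((2 * d + 1) * n + 2 * k - 1)!

theorem normArray_nonneg (d k n : ℕ) : 0 ≤ normArray d k n := by
  have := coeffArray_nonneg d k n
  rw [normArray]
  positivity

theorem coeffArray_eq (d k n : ℕ) : coeffArray d k n =
    normArray d k n * ((2 * d + 1) * n + 2 * k - 1)! / (4 ^ k * (2 * d + 1) ^ n * n !) := by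
  have h : (((2 * d + 1) * n + 2 * k - 1)! : ℝ) ≠ 0 := by positivity
  rw [normArray]
  field_simp

/-- The normalization is chosen so that the diagonal term of the Lenard recursion gets coefficient
1; only the nonnegative convolution remains as increment. -/
theorem normArray_succ_eq (d k n : ℕ) :
    normArray d (k + 2) n = normArray d (k + 1) n
      + (∑ x ∈ Finset.HasAntidiagonal.antidiagonal n,
          (8 * ((2 * d + 1) * x.2 + 2 * (k + 1)) + 4 * ((2 * d + 1) * x.1 + 2))
            * (coeffArray d 1 x.1 * coeffArray d (k + 1) x.2))
        * (4 ^ (k + 1) * (2 * d + 1) ^ n * n !)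
        / (((2 * d + 1) * n + 2 * (k + 1) + 2) * ((2 * d + 1) * n + 2 * k + 3)!) := by
  have h := coeffArray_succ d (k + 1) n
  set S := ∑ x ∈ Finset.HasAntidiagonal.antidiagonal n,
          (8 * ((2 * d + 1) * (x.2 : ℝ) + 2 * (k + 1 : ℕ)) + 4 * ((2 * d + 1) * x.1 + 2))
            * (coeffArray d 1 x.1 * coeffArray d (k + 1) x.2) with hS
  have hS' : ∑ x ∈ Finset.HasAntidiagonal.antidiagonal n,
          (8 * ((2 * d + 1) * (x.2 : ℝ) + 2 * (k + 1)) + 4 * ((2 * d + 1) * x.1 + 2))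
            * (coeffArray d 1 x.1 * coeffArray d (k + 1) x.2) = S := by
    rw [hS]; push_cast; rfl
  rw [hS', normArray, normArray,
    show (2 * d + 1) * n + 2 * (k + 2) - 1 = (2 * d + 1) * n + 2 * k + 3 by omega,
    show (2 * d + 1) * n + 2 * (k + 1) - 1 = (2 * d + 1) * n + 2 * k + 1 by omega,
    Nat.factorial_succ, Nat.factorial_succ]
  have hf : (((2 * d + 1) * n + 2 * k + 1)! : ℝ) ≠ 0 := by positivity
  have hb : coeffArray d (k + 2) n = (((2 * d + 1) * n + 2 * (k + 1 : ℕ))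
      * ((2 * d + 1) * n + 2 * (k + 1 : ℕ) + 1) * ((2 * d + 1) * n + 2 * (k + 1 : ℕ) + 2)
      * coeffArray d (k + 1) n + S) / (4 * ((2 * d + 1) * n + 2 * (k + 1 : ℕ) + 2)) := by
    rw [← h]
    have : (4 * ((2 * d + 1) * n + 2 * (k + 1 : ℕ) + 2) : ℝ) ≠ 0 := by positivity
    rw [mul_div_cancel_left₀ _ this]
  rw [hb]
  push_cast
  have h1 : ((2 * d + 1) * n + 2 * k + 1 + 1 : ℝ) ≠ 0 := by positivity
  have h2 : ((2 * d + 1) * n + 2 * k + 2 + 1 : ℝ) ≠ 0 := by positivity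
  have h3 : ((2 * d + 1) * n + 2 * (k + 1) + 2 : ℝ) ≠ 0 := by positivity
  field_simp
  ring

theorem normArray_mono (d n : ℕ) : Monotone fun k => normArray d (k + 1) n := by
  refine monotone_nat_of_le_succ fun k => ?_
  rw [normArray_succ_eq d k n]
  refine le_add_of_nonneg_right (div_nonneg (mul_nonneg (Finset.sum_nonneg fun x _ => ?_)
    (by positivity)) (by positivity))
  have := coeffArray_nonneg d 1 x.1
  have := coeffArray_nonneg d (k + 1) x.2
  positivity

/-- For n = 0 the convolution has a single term, so the recursion is a product. This is where π
enters. -/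
theorem normArray_zero_right (d k : ℕ) : normArray d (k + 1) 0 =
    (2 * (k + 1)) / (2 * (k + 1) + 1) / Real.Wallis.W (k + 1) := by
  induction k with
  | zero =>
    rw [normArray, coeffArray_one_zero, Real.Wallis.W_succ]
    simp [Real.Wallis.W]
    norm_num
  | succ k ih =>
    rw [normArray_succ_eq, Finset.Nat.antidiagonal_zero, Finset.sum_singleton,
      coeffArray_one_zero, coeffArray_eq d (k + 1) 0, ih, Real.Wallis.W_succ (k + 1)]
    have hW := (Real.Wallis.W_pos (k + 1)).ne'
    rw [show (2 * d + 1) * 0 + 2 * (k + 1) - 1 = 2 * k + 1 by omega,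
      show (2 * d + 1) * 0 + 2 * k + 3 = 2 * k + 1 + 1 + 1 by omega,
      Nat.factorial_succ (2 * k + 1 + 1), Nat.factorial_succ (2 * k + 1)]
    have hf : ((2 * k + 1)! : ℝ) ≠ 0 := by positivity
    push_cast
    simp only [mul_zero, zero_add, pow_zero, mul_one, Nat.factorial_zero, Nat.cast_one]
    field_simp
    ring

theorem tendsto_normArray_zero (d : ℕ) :
    Tendsto (fun k => normArray d (k + 1) 0) atTop (𝓝 (2 / Real.pi)) := by
  have h1 : Tendsto (fun k : ℕ => (2 * ((k : ℝ) + 1)) / (2 * (k + 1) + 1)) atTop (𝓝 1) := by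
    have h := tendsto_one_div_add_atTop_nhds_zero_nat (𝕜 := ℝ)
    have h' : Tendsto (fun k : ℕ => 2 / (2 + 1 / ((k : ℝ) + 1))) atTop (𝓝 (2 / (2 + 0))) :=
      tendsto_const_nhds.div (tendsto_const_nhds.add h) (by norm_num)
    norm_num at h'
    refine h'.congr fun k => ?_
    have : (k : ℝ) + 1 ≠ 0 := by positivity
    field_simp
  have h2 := Real.Wallis.tendsto_W_nhds_pi_div_two.comp (tendsto_add_atTop_nat 1)
  have h3 := h1.div h2 (by positivity)
  rw [show (1 : ℝ) / (Real.pi / 2) = 2 / Real.pi by field_simp] at h3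
  exact h3.congr fun k => (normArray_zero_right d k).symm

/-! ### The limit along rows -/

/-- The contribution of the pair `(b_j, b_{k+d-j})` to the normalized merging identity. -/
def mergeTerm (d n k j : ℕ) (x : ℕ × ℕ) : ℝ :=
  4 ^ d * ((((2 * d + 1) * x.2 + 2 * (k + d - j : ℕ)) - ((2 * d + 1) * x.1 + 2 * j))
    * (coeffArray d j x.1 * coeffArray d (k + d - j) x.2)) * (4 ^ k * (2 * d + 1) ^ n * n !)
    / ((2 * d + 1) * n + 2 * k + 2 * d)!

/-- Since b_0 = 1, the j = 0 part of the Wronskian sum is just b_{k+d}', and the normalization turns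
it into the entry at k + d with coefficient 1. -/
theorem normArray_merging (d n k : ℕ) (hk : 1 ≤ k) :
    normArray d k (n + 1) = normArray d (k + d) n +
      ∑ j ∈ Finset.range d, ∑ x ∈ Finset.HasAntidiagonal.antidiagonal n,
        mergeTerm d n k (j + 1) x := by
  have h := coeffArray_merging d k n
  have hexp : (2 * d + 1) * (n + 1) + 2 * k - 1 = (2 * d + 1) * n + 2 * k + 2 * d := by
    rw [mul_add]; omega
  have e : normArray d k (n + 1) = (2 * d + 1) * (n + 1) * coeffArray d k (n + 1)
      * (4 ^ k * (2 * d + 1) ^ n * n !) / ((2 * d + 1) * n + 2 * k + 2 * d)! := by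
    rw [normArray, hexp, Nat.factorial_succ]
    push_cast
    ring
  have h0 : ∑ x ∈ Finset.HasAntidiagonal.antidiagonal n, mergeTerm d n k 0 x =
      normArray d (k + d) n := by
    rw [Finset.sum_eq_single (0, n)]
    · have hexp' : (2 * d + 1) * n + 2 * k + 2 * d = (2 * d + 1) * n + 2 * (k + d) - 1 + 1 := by
        omega
      have hc : (((2 * d + 1) * n + 2 * (k + d) - 1 : ℕ) : ℝ) + 1
          = (2 * d + 1) * n + 2 * (k + d) := by
        rw [Nat.cast_sub (by omega)]
        push_cast
        ring
      rw [mergeTerm, normArray, coeffArray_zero, hexp', Nat.factorial_succ]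
      push_cast [-Nat.cast_sub]
      rw [hc]
      have : ((2 * d + 1) * n + 2 * (k + d) : ℝ) ≠ 0 := by positivity
      have hf : (((2 * d + 1) * n + 2 * (k + d) - 1)! : ℝ) ≠ 0 := by positivity
      simp only [Nat.sub_zero, Nat.cast_add]
      field_simp
      ring
    · rintro ⟨i, j⟩ hx hne
      have h : i + j = n := Finset.HasAntidiagonal.mem_antidiagonal.1 hx
      have : i ≠ 0 := by rintro rfl; exact hne (by simp at h; simp [h])
      simp [mergeTerm, coeffArray_zero, this]
    · simp
  rw [e, h, Finset.sum_range_succ', ← h0, add_comm]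
  simp only [mergeTerm, ← Finset.sum_div, ← Finset.sum_mul, ← Finset.mul_sum]
  ring

/-- Let E = (2d+1)n + 2k + 2d. As j + 1 ≥ 1, the factorial carried by the second factor is at most
(E-2)!. Of the two missing factors, E absorbs the Wronskian weight and E - 1 ≥ k leaves 1/k. -/
theorem mergeTerm_bound {d n k j : ℕ} {x : ℕ × ℕ} (hk : 1 ≤ k) (hj : j < d)
    (hx : x.1 + x.2 = n) : |mergeTerm d n k (j + 1) x| ≤
      4 ^ (j + 1) * coeffArray d (j + 1) x.1 * (2 * d + 1) ^ x.1 * n ! *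
        normArray d (k + d - (j + 1)) x.2 * (1 / k) := by
  obtain ⟨l, hl⟩ : ∃ l, k + d = l + (j + 1) := ⟨k + d - (j + 1), by omega⟩
  have hl1 : 1 ≤ l := by omega
  have hl' : k + d - (j + 1) = l := by omega
  obtain ⟨i, i'⟩ := x
  simp only at hx ⊢
  subst hx
  rw [mergeTerm, hl', coeffArray_eq d l i']
  simp only
  set E : ℕ := (2 * d + 1) * (i + i') + 2 * k + 2 * d with hE
  have hEe : (2 * d + 1) * i' + 2 * l + ((2 * d + 1) * i + 2 * (j + 1)) = E := by
    rw [hE, mul_add (2 * d + 1) i i']; omega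
  have hE2 : 2 ≤ E := by omega
  have hfac : ((2 * d + 1) * i' + 2 * l - 1)! * ((E - 1) * E) ≤ E ! := by
    obtain ⟨F, hF⟩ : ∃ F, E = F + 2 := ⟨E - 2, by omega⟩
    rw [hF, Nat.factorial_succ, Nat.factorial_succ, show F + 2 - 1 = F + 1 by omega]
    have : ((2 * d + 1) * i' + 2 * l - 1)! ≤ F ! := Nat.factorial_le (by omega)
    calc _ ≤ F ! * ((F + 1) * (F + 2)) := Nat.mul_le_mul_right _ this
      _ = _ := by ring
  have hB := coeffArray_nonneg d (j + 1) i
  have hN := normArray_nonneg d l i'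
  have hfac' : (((2 * d + 1) * i' + 2 * l - 1)! : ℝ) * (E / (E ! : ℝ)) ≤ 1 / k := by
    have hk1 : (k : ℝ) ≤ ((E - 1 : ℕ) : ℝ) := by exact_mod_cast (by omega : k ≤ E - 1)
    have hkpos : (0 : ℝ) < k := by exact_mod_cast hk
    have hEpos : (0 : ℝ) < E ! := by positivity
    have h1 : (((2 * d + 1) * i' + 2 * l - 1)! : ℝ) * (((E - 1 : ℕ) : ℝ) * E) ≤ E ! := by
      exact_mod_cast hfac
    rw [mul_div_assoc', div_le_div_iff₀ hEpos hkpos, one_mul]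
    refine le_trans ?_ h1
    rw [mul_assoc, mul_comm (E : ℝ)]
    exact mul_le_mul_of_nonneg_left (mul_le_mul_of_nonneg_right hk1 (Nat.cast_nonneg _))
      (Nat.cast_nonneg _)
  have habs : |((2 * d + 1) * (i' : ℝ) + 2 * (l : ℝ)) - ((2 * d + 1) * i + 2 * ((j + 1 : ℕ) : ℝ))|
      ≤ E := by
    have hE' : ((2 * d + 1) * (i' : ℝ) + 2 * (l : ℝ)) + ((2 * d + 1) * i + 2 * ((j + 1 : ℕ) : ℝ))
        = E := by exact_mod_cast hEe
    rw [← hE', abs_le]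
    have h1 : (0 : ℝ) ≤ (2 * d + 1) * (i' : ℝ) + 2 * (l : ℝ) := by positivity
    have h2 : (0 : ℝ) ≤ (2 * d + 1) * (i : ℝ) + 2 * ((j + 1 : ℕ) : ℝ) := by positivity
    constructor <;> linarith
  have hpow : (4 : ℝ) ^ d * 4 ^ k = 4 ^ l * 4 ^ (j + 1) := by
    rw [← pow_add, ← pow_add, ← hl, add_comm]
  set A := ((2 * d + 1) * (i' : ℝ) + 2 * (l : ℝ)) - ((2 * d + 1) * i + 2 * ((j + 1 : ℕ) : ℝ))
    with hA
  set f : ℝ := (((2 * d + 1) * i' + 2 * l - 1)! : ℝ) with hf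
  have hf0 : 0 ≤ f := by positivity
  have hi' : (1 : ℝ) ≤ (i' ! : ℝ) := by exact_mod_cast Nat.factorial_pos i'
  have e : 4 ^ d * (A * (coeffArray d (j + 1) i * (normArray d l i' * f /
      (4 ^ l * (2 * d + 1) ^ i' * i' !)))) * (4 ^ k * (2 * d + 1) ^ (i + i') * (i + i')!) / (E ! : ℝ)
      = (4 ^ (j + 1) * coeffArray d (j + 1) i * (2 * d + 1) ^ i * (i + i')! * normArray d l i')
        * (1 / (i' ! : ℝ)) * (f * (A / (E ! : ℝ))) := by
    have : (E ! : ℝ) ≠ 0 := by positivity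
    rw [pow_add]
    field_simp
    linear_combination (A * coeffArray d (j + 1) i * normArray d l i' * f) * hpow
  rw [e, abs_mul, abs_mul]
  have hc0 : 0 ≤ 4 ^ (j + 1) * coeffArray d (j + 1) i * (2 * d + 1) ^ i * (i + i')!
      * normArray d l i' := by positivity
  rw [abs_of_nonneg hc0, abs_of_nonneg (by positivity : (0 : ℝ) ≤ 1 / (i' ! : ℝ)), abs_mul,
    abs_of_nonneg hf0, abs_div, abs_of_nonneg (by positivity : (0 : ℝ) ≤ (E ! : ℝ))]
  have h1 : f * (|A| / (E ! : ℝ)) ≤ 1 / k := le_trans (by gcongr) hfac'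
  have h2 : (1 : ℝ) / (i' ! : ℝ) ≤ 1 := by
    rw [div_le_one (by positivity)]; exact hi'
  calc _ ≤ (4 ^ (j + 1) * coeffArray d (j + 1) i * (2 * d + 1) ^ i * (i + i')!
      * normArray d l i') * 1 * (1 / k) := by gcongr
    _ = _ := by ring

/-- The merging identity passes the limit from n to n + 1; each other term is at most 1/k times a
convergent sequence, by the induction hypothesis at some index ≤ n. -/
theorem tendsto_normArray (d n : ℕ) :
    Tendsto (fun k => normArray d k n) atTop (𝓝 (2 / Real.pi)) := by
  induction n using Nat.strong_induction_on with
  | _ n ih =>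
    cases n with
    | zero => exact (tendsto_add_atTop_iff_nat 1).1 (tendsto_normArray_zero d)
    | succ n =>
      have hmain := (tendsto_add_atTop_iff_nat (f := fun k => normArray d k n) d).2
        (ih n (Nat.lt_succ_self n))
      have hterm : ∀ j ∈ Finset.range d, ∀ x ∈ Finset.HasAntidiagonal.antidiagonal n,
          Tendsto (fun k => mergeTerm d n k (j + 1) x) atTop (𝓝 0) := by
        intro j hj x hx
        have hj := Finset.mem_range.1 hj
        have hx : x.1 + x.2 = n := Finset.HasAntidiagonal.mem_antidiagonal.1 hx
        have hl : Tendsto (fun k => k + d - (j + 1)) atTop atTop :=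
          tendsto_atTop_mono (fun k => show k ≤ _ by omega) tendsto_id
        have hlim := (((ih x.2 (by omega)).comp hl).const_mul
          (4 ^ (j + 1) * coeffArray d (j + 1) x.1 * (2 * d + 1) ^ x.1 * n !)).mul
          tendsto_one_div_atTop_nhds_zero_nat
        rw [mul_zero] at hlim
        refine squeeze_zero_norm' ?_ hlim
        filter_upwards [eventually_ge_atTop 1] with k hk
        exact mergeTerm_bound hk hj hx
      have hsum := tendsto_finsetSum _ fun j hj => tendsto_finsetSum _ (hterm j hj)
      have htot := hmain.add hsum
      simp only [Finset.sum_const_zero, add_zero] at htot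
      refine htot.congr' ?_
      filter_upwards [eventually_ge_atTop 1] with k hk
      exact (normArray_merging d n k hk).symm

theorem normArray_le (d k n : ℕ) : normArray d (k + 1) n ≤ 2 / Real.pi :=
  (normArray_mono d n).ge_of_tendsto
    ((tendsto_add_atTop_iff_nat (f := fun k => normArray d k n) 1).2 (tendsto_normArray d n)) k

theorem normArray_le_one (d k n : ℕ) : normArray d (k + 1) n ≤ 1 := by
  refine (normArray_le d k n).trans ?_
  rw [div_le_one Real.pi_pos]
  linarith [Real.pi_gt_three]

/-! ### Binomial estimates -/

theorem add_le_choose (s t : ℕ) : s + 1 + (t + 1) ≤ (s + 1 + (t + 1)).choose (s + 1) := by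
  induction s generalizing t with
  | zero => simp
  | succ s ih =>
    induction t with
    | zero =>
      rw [Nat.choose_symm_add]; simp
    | succ t iht =>
      have h1 := ih (t + 1)
      rw [show s + 1 + 1 + (t + 1 + 1) = (s + 1 + (t + 1 + 1)) + 1 by ring, Nat.choose_succ_succ']
      rw [show s + 1 + 1 + (t + 1) = s + 1 + (t + 1 + 1) by ring] at iht
      omega

theorem mul_le_two_mul_choose (s t : ℕ) :
    (s + t + 4) * (s + t + 3) ≤ 2 * (s + t + 4).choose (s + 2) := by
  induction s generalizing t with
  | zero =>
    have h := Nat.choose_two_right (0 + t + 4)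
    rw [zero_add] at h ⊢
    have h2 := Nat.div_mul_cancel (Nat.even_mul_pred_self (t + 4)).two_dvd
    rw [← h] at h2
    rw [show t + 4 - 1 = t + 3 by omega] at h2
    rw [zero_add]
    linarith
  | succ s ih =>
    induction t with
    | zero =>
      have h := Nat.choose_two_right (s + 1 + 0 + 4)
      have h2 := Nat.div_mul_cancel (Nat.even_mul_pred_self (s + 1 + 0 + 4)).two_dvd
      rw [← h, show s + 1 + 0 + 4 - 1 = s + 1 + 0 + 3 by omega] at h2
      rw [← Nat.choose_symm_of_eq_add (show s + 1 + 0 + 4 = 2 + (s + 1 + 2) by ring)]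
      linarith
    | succ t iht =>
      have h1 := ih (t + 1)
      rw [show s + 1 + (t + 1) + 4 = (s + (t + 1) + 4) + 1 by ring,
        show s + 1 + 2 = s + 2 + 1 by ring, Nat.choose_succ_succ]
      rw [show s + 1 + t + 4 = s + (t + 1) + 4 by ring,
        show s + 1 + 2 = s + 2 + 1 by ring] at iht
      nlinarith

theorem choose_mul_choose_le (a b i j : ℕ) :
    a.choose i * b.choose j ≤ (a + b).choose (i + j) := by
  rw [Nat.add_choose_eq]
  exact Finset.single_le_sum (f := fun x : ℕ × ℕ => a.choose x.1 * b.choose x.2)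
    (fun _ _ => Nat.zero_le _) (Finset.HasAntidiagonal.mem_antidiagonal.2 rfl : (i, j) ∈ _)

theorem cast_add_choose_left (i j : ℕ) :
    ((i + j).choose i : ℝ) = (i + j)! / (i ! * j !) := by
  rw [Nat.choose_symm_add, Nat.add_choose,
    Nat.cast_div (Nat.factorial_mul_factorial_dvd_factorial_add i j) (by positivity)]
  push_cast
  rfl

/-! ### The uniform rate of convergence -/

/-- The weights are at most 8 times the denominator, the powers of 4 leave 1/4, and the normalized
entries are at most 1; hence the factor 2. -/
theorem normArray_step_le (d k n : ℕ) : normArray d (k + 2) n ≤ normArray d (k + 1) n +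
    2 * ∑ x ∈ Finset.HasAntidiagonal.antidiagonal n,
      (n.choose x.1 * ((2 * d + 1) * x.1 + 1)! * ((2 * d + 1) * x.2 + 2 * k + 1)! : ℝ)
        / ((2 * d + 1) * n + 2 * k + 3)! := by
  rw [normArray_succ_eq, Finset.mul_sum, Finset.sum_mul, Finset.sum_div]
  refine add_le_add le_rfl (Finset.sum_le_sum fun x hx => ?_)
  obtain ⟨i, j⟩ := x
  have hx : i + j = n := Finset.HasAntidiagonal.mem_antidiagonal.1 hx
  subst hx
  simp only
  rw [coeffArray_eq d 1 i, coeffArray_eq d (k + 1) j,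
    show (2 * d + 1) * i + 2 * 1 - 1 = (2 * d + 1) * i + 1 by omega,
    show (2 * d + 1) * j + 2 * (k + 1) - 1 = (2 * d + 1) * j + 2 * k + 1 by omega]
  have hg : normArray d 1 i * normArray d (k + 1) j ≤ 1 :=
    mul_le_one₀ (normArray_le_one d 0 i) (normArray_nonneg _ _ _) (normArray_le_one d k j)
  have hg0 : 0 ≤ normArray d 1 i * normArray d (k + 1) j :=
    mul_nonneg (normArray_nonneg _ _ _) (normArray_nonneg _ _ _)
  have hch := cast_add_choose_left i j
  set P : ℝ := (2 * d + 1) * (i + j : ℕ) + 2 * (k + 1) + 2 with hP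
  have hPpos : 0 < P := by positivity
  set w : ℝ := 8 * ((2 * d + 1) * j + 2 * (k + 1)) + 4 * ((2 * d + 1) * i + 2) with hw
  have hwP : w / P ≤ 8 := by
    rw [div_le_iff₀ hPpos, hw, hP]
    push_cast
    nlinarith [mul_nonneg (by positivity : (0 : ℝ) ≤ 2 * d + 1) (Nat.cast_nonneg i : (0 : ℝ) ≤ i)]
  have hw0 : 0 ≤ w / P := by positivity
  have e : w * (normArray d 1 i * ((2 * d + 1) * i + 1)! / (4 ^ 1 * (2 * d + 1) ^ i * i !)
      * (normArray d (k + 1) j * ((2 * d + 1) * j + 2 * k + 1)!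
        / (4 ^ (k + 1) * (2 * d + 1) ^ j * j !)))
      * (4 ^ (k + 1) * (2 * d + 1) ^ (i + j) * (i + j)!)
      / (P * ((2 * d + 1) * (i + j) + 2 * k + 3)!) =
      ((w / P) * (normArray d 1 i * normArray d (k + 1) j) / 4) *
      (((i + j).choose i * ((2 * d + 1) * i + 1)! * ((2 * d + 1) * j + 2 * k + 1)! : ℝ)
        / ((2 * d + 1) * (i + j) + 2 * k + 3)!) := by
    rw [hch, pow_add (2 * (d : ℝ) + 1)]
    have : (((2 * d + 1) * (i + j) + 2 * k + 3)! : ℝ) ≠ 0 := by positivity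
    field_simp
  rw [e]
  refine mul_le_mul_of_nonneg_right ?_ (by positivity)
  have := mul_le_mul hwP hg hg0 (by norm_num)
  linarith

/-- Split N = (2d+1)(i+j) + 2k + 2 as (i+j) + M. One term of Vandermonde's identity absorbs the
binomial `(i + j).choose i` and leaves the reciprocal of a binomial of M; the extra factor N + 1 ≥ M
gives 1/M. -/
theorem choose_mul_factorial_div_le {d : ℕ} (hd : 1 ≤ d) (k i j : ℕ) :
    (((i + j).choose i * ((2 * d + 1) * i + 1)! * ((2 * d + 1) * j + 2 * k + 1)! : ℝ)
        / ((2 * d + 1) * (i + j) + 2 * k + 3)!) ≤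
      1 / (2 * d * (i + j) + 2 * k + 2) *
        (1 / (2 * d * (i + j) + 2 * k + 2 : ℕ).choose (2 * d * i + 1)) := by
  set M := 2 * d * (i + j) + 2 * k + 2 with hM
  set N := (2 * d + 1) * (i + j) + 2 * k + 2 with hN
  have hNM : N = (i + j) + M := by rw [hN, hM]; ring
  have hV : (i + j).choose i * M.choose (2 * d * i + 1) ≤ N.choose ((2 * d + 1) * i + 1) := by
    have := choose_mul_choose_le (i + j) M i (2 * d * i + 1)
    rwa [← hNM, show i + (2 * d * i + 1) = (2 * d + 1) * i + 1 by ring] at this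
  have hfac : N.choose ((2 * d + 1) * i + 1) * ((2 * d + 1) * i + 1)!
      * ((2 * d + 1) * j + 2 * k + 1)! = N ! := by
    have h := Nat.add_choose_mul_factorial_mul_factorial ((2 * d + 1) * i + 1)
      ((2 * d + 1) * j + 2 * k + 1)
    rwa [← Nat.choose_symm_add,
      show (2 * d + 1) * i + 1 + ((2 * d + 1) * j + 2 * k + 1) = N by rw [hN]; ring] at h
  have hMpos : 0 < M.choose (2 * d * i + 1) := Nat.choose_pos (by rw [hM]; nlinarith)
  have hM0 : (0 : ℝ) < M := by rw [hM]; positivity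
  have hc0 : (0 : ℝ) < M.choose (2 * d * i + 1) := by exact_mod_cast hMpos
  have hMc : (2 * d * (i + j) + 2 * k + 2 : ℝ) = M := by rw [hM]; push_cast; ring
  rw [hMc, one_div_mul_one_div, Nat.factorial_succ, div_le_div_iff₀ (by positivity) (by positivity),
    one_mul]
  have hnat : (i + j).choose i * ((2 * d + 1) * i + 1)! * ((2 * d + 1) * j + 2 * k + 1)!
      * (M * M.choose (2 * d * i + 1)) ≤ (N + 1) * N ! := by
    rw [← hfac]
    calc _ = M * (((i + j).choose i * M.choose (2 * d * i + 1)) * ((2 * d + 1) * i + 1)!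
          * ((2 * d + 1) * j + 2 * k + 1)!) := by ring
      _ ≤ (N + 1) * (N.choose ((2 * d + 1) * i + 1) * ((2 * d + 1) * i + 1)!
          * ((2 * d + 1) * j + 2 * k + 1)!) := by gcongr; omega
  exact_mod_cast hnat

theorem choose_ge_boundary (d k i j : ℕ) :
    2 * d * (i + j) + 2 * k + 2 ≤ (2 * d * (i + j) + 2 * k + 2).choose (2 * d * i + 1) := by
  have h := add_le_choose (2 * d * i) (2 * d * j + 2 * k)
  rwa [show 2 * d * i + 1 + (2 * d * j + 2 * k + 1) = 2 * d * (i + j) + 2 * k + 2 by ring] at h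

theorem choose_ge_interior {d : ℕ} (hd : 1 ≤ d) (k i j : ℕ) (hi : i ≠ 0) (hj : j ≠ 0) :
    (2 * d * (i + j) + 2 * k + 2) * (2 * d * (i + j) + 2 * k + 1) ≤
      2 * (2 * d * (i + j) + 2 * k + 2).choose (2 * d * i + 1) := by
  have h1 : 1 ≤ d * i := Nat.mul_pos hd (Nat.pos_of_ne_zero hi)
  have h2 : 1 ≤ d * j := Nat.mul_pos hd (Nat.pos_of_ne_zero hj)
  obtain ⟨s, hs⟩ : ∃ s, 2 * d * i + 1 = s + 2 := ⟨2 * d * i - 1, by rw [mul_assoc]; omega⟩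
  obtain ⟨t, ht⟩ : ∃ t, 2 * d * j + 2 * k + 1 = t + 2 :=
    ⟨2 * d * j + 2 * k - 1, by rw [mul_assoc]; omega⟩
  have h := mul_le_two_mul_choose s t
  have e : 2 * d * (i + j) + 2 * k + 2 = s + t + 4 := by rw [mul_add]; omega
  rwa [e, show 2 * d * (i + j) + 2 * k + 1 = s + t + 3 by omega, hs]

theorem sum_one_div_choose_le {d : ℕ} (hd : 1 ≤ d) (k n : ℕ) :
    ∑ x ∈ Finset.HasAntidiagonal.antidiagonal n,
      (1 : ℝ) / (2 * d * n + 2 * k + 2 : ℕ).choose (2 * d * x.1 + 1)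
        ≤ 4 / (2 * d * n + 2 * k + 2) := by
  set M : ℕ := 2 * d * n + 2 * k + 2 with hM
  have hMc : (2 * d * n + 2 * k + 2 : ℝ) = M := by rw [hM]; push_cast; ring
  have hM2 : 2 ≤ M := by omega
  have hMn : 2 * (n + 1) ≤ M := by rw [hM]; nlinarith
  have hM2' : (2 : ℝ) ≤ M := by exact_mod_cast hM2
  have hMn' : 2 * ((n : ℝ) + 1) ≤ M := by exact_mod_cast hMn
  have hM0 : (0 : ℝ) < M := by linarith
  have hM1 : (0 : ℝ) < M - 1 := by linarith
  -- At the two ends the binomial is only known to be at least M. In the interior it is at least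
  -- M(M-1)/2, and n + 1 ≤ M/2 bounds the number of terms.
  have hpt : ∀ x ∈ Finset.HasAntidiagonal.antidiagonal n,
      (1 : ℝ) / M.choose (2 * d * x.1 + 1) ≤
        (if x = (0, n) then 1 / (M : ℝ) else 0) + (if x = (n, 0) then 1 / (M : ℝ) else 0)
          + 2 / (M * (M - 1)) := by
    rintro ⟨i, j⟩ hx
    have hx : i + j = n := Finset.HasAntidiagonal.mem_antidiagonal.1 hx
    have hq : (0 : ℝ) ≤ 2 / (M * (M - 1)) := by positivity
    have hb : (1 : ℝ) / M.choose (2 * d * i + 1) ≤ 1 / M := by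
      have h := choose_ge_boundary d k i j
      rw [hx, ← hM] at h
      exact one_div_le_one_div_of_le hM0 (by exact_mod_cast h)
    have hn0 : (0 : ℝ) ≤ 1 / M := by positivity
    by_cases hi : i = 0
    · have h0 : j = n := by omega
      subst hi h0
      rw [if_pos rfl]
      split_ifs <;> linarith
    by_cases hj : j = 0
    · have h0 : i = n := by omega
      subst hj h0
      rw [if_pos rfl]
      split_ifs <;> linarith
    · rw [if_neg (by simp [hi]), if_neg (by simp [hj]), zero_add, zero_add]
      have h := choose_ge_interior hd k i j hi hj
      rw [hx, show 2 * d * n + 2 * k + 1 = M - 1 by omega, ← hM] at h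
      have h' : (M : ℝ) * (M - 1) ≤ 2 * M.choose (2 * d * i + 1) := by
        have : ((M * (M - 1) : ℕ) : ℝ) ≤ ((2 * M.choose (2 * d * i + 1) : ℕ) : ℝ) := by
          exact_mod_cast h
        rw [Nat.cast_mul, Nat.cast_sub (by omega)] at this
        push_cast at this
        exact this
      have hc : (0 : ℝ) < M.choose (2 * d * i + 1) := by nlinarith [mul_pos hM0 hM1]
      rw [div_le_div_iff₀ hc (by positivity)]
      linarith
  refine (Finset.sum_le_sum hpt).trans ?_
  rw [Finset.sum_add_distrib, Finset.sum_add_distrib, Finset.sum_ite_eq', Finset.sum_ite_eq',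
    if_pos (Finset.HasAntidiagonal.mem_antidiagonal.2 (by simp)),
    if_pos (Finset.HasAntidiagonal.mem_antidiagonal.2 (by simp)), Finset.sum_const,
    Finset.Nat.card_antidiagonal, nsmul_eq_mul, hMc]
  have h1 : ((n + 1 : ℕ) : ℝ) * (2 / (M * (M - 1))) ≤ 2 / M := by
    rw [mul_div_assoc', div_le_div_iff₀ (by positivity) hM0]
    push_cast
    nlinarith [mul_le_mul_of_nonneg_right hMn' hM0.le]
  calc _ ≤ 1 / (M : ℝ) + 1 / M + 2 / M := by linarith
    _ = 4 / M := by ring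

theorem normArray_step_le_sq {d : ℕ} (hd : 1 ≤ d) (k n : ℕ) :
    normArray d (k + 2) n ≤ normArray d (k + 1) n + 2 / (n + k + 1) ^ 2 := by
  refine (normArray_step_le d k n).trans (add_le_add le_rfl ?_)
  have h1 : ∑ x ∈ Finset.HasAntidiagonal.antidiagonal n,
      (n.choose x.1 * ((2 * d + 1) * x.1 + 1)! * ((2 * d + 1) * x.2 + 2 * k + 1)! : ℝ)
        / ((2 * d + 1) * n + 2 * k + 3)! ≤
      1 / (2 * d * n + 2 * k + 2) * (4 / (2 * d * n + 2 * k + 2)) := by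
    refine le_trans ?_ (mul_le_mul_of_nonneg_left (sum_one_div_choose_le hd k n) (by positivity))
    rw [Finset.mul_sum]
    refine Finset.sum_le_sum fun x hx => ?_
    obtain ⟨i, j⟩ := x
    have hx : i + j = n := Finset.HasAntidiagonal.mem_antidiagonal.1 hx
    subst hx
    have h := choose_mul_factorial_div_le hd k i j
    push_cast at h ⊢
    exact h
  have h2 : 2 * ((n : ℝ) + k + 1) ≤ 2 * d * n + 2 * k + 2 := by
    have : (1 : ℝ) ≤ d := by exact_mod_cast hd
    nlinarith [mul_le_mul_of_nonneg_right this (Nat.cast_nonneg n : (0 : ℝ) ≤ n)]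
  have h3 : (0 : ℝ) < n + k + 1 := by positivity
  calc _ ≤ 2 * (1 / (2 * d * n + 2 * k + 2) * (4 / (2 * d * n + 2 * k + 2)) : ℝ) := by linarith
    _ ≤ 2 * (1 / (2 * (n + k + 1)) * (4 / (2 * (n + k + 1)))) := by gcongr
    _ = 2 / (n + k + 1) ^ 2 := by field_simp; ring

/-- Since 2/(n+k+1)² ≤ 2/(n+k) - 2/(n+k+1), adding 2/(n+k) makes the sequence in k nonincreasing, so
it stays above its limit 2/π. The error is small in n for fixed k, which allows the exchange of
limits. -/
theorem le_normArray {d : ℕ} (hd : 1 ≤ d) (k n : ℕ) (hn : 1 ≤ n) :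
    2 / Real.pi - 2 / (n + k) ≤ normArray d (k + 1) n := by
  have hanti : Antitone fun k : ℕ => normArray d (k + 1) n + 2 / ((n : ℝ) + k) := by
    refine antitone_nat_of_succ_le fun k => ?_
    have h := normArray_step_le_sq hd k n
    have hpos : (0 : ℝ) < n + k := by
      have : (1 : ℝ) ≤ n := by exact_mod_cast hn
      positivity
    have h2 : 2 / ((n : ℝ) + k + 1) ^ 2 ≤ 2 / (n + k) - 2 / (n + k + 1) := by
      rw [div_sub_div _ _ hpos.ne' (by positivity), div_le_div_iff₀ (by positivity) (by positivity)]
      nlinarith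
    push_cast
    rw [show (n : ℝ) + (k + 1) = n + k + 1 by ring]
    linarith
  have hlim : Tendsto (fun k : ℕ => normArray d (k + 1) n + 2 / ((n : ℝ) + k)) atTop
      (𝓝 (2 / Real.pi + 0)) := by
    refine ((tendsto_add_atTop_iff_nat (f := fun k => normArray d k n) 1).2
      (tendsto_normArray d n)).add ?_
    exact tendsto_const_nhds.div_atTop
      (tendsto_atTop_add_const_left _ _ tendsto_natCast_atTop_atTop)
  have := hanti.le_of_tendsto hlim k
  simp only [add_zero] at this
  linarith

theorem tendsto_normArray_column {d : ℕ} (hd : 1 ≤ d) :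
    Tendsto (fun n => normArray d d n) atTop (𝓝 (2 / Real.pi)) := by
  obtain ⟨k, rfl⟩ : ∃ k, d = k + 1 := ⟨d - 1, by omega⟩
  have hlow : Tendsto (fun n : ℕ => 2 / Real.pi - 2 / ((n : ℝ) + k)) atTop
      (𝓝 (2 / Real.pi - 0)) :=
    tendsto_const_nhds.sub (tendsto_const_nhds.div_atTop
      (tendsto_atTop_add_const_right _ _ tendsto_natCast_atTop_atTop))
  rw [sub_zero] at hlow
  refine tendsto_of_tendsto_of_tendsto_of_le_of_le' hlow tendsto_const_nhds ?_ ?_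
  · filter_upwards [eventually_ge_atTop 1] with n hn
    exact le_normArray hd k n hn
  · exact Eventually.of_forall fun n => normArray_le (k + 1) k n

/-! ### Asymptotics of the formal solution -/

/-- The size `((2d+1)(n+1) - 1)! / ((2d+1)^n n!)` of the coefficient `v_{n+1}`. -/
def sizeSeq (d n : ℕ) : ℝ := ((2 * d + 1) * n + 2 * d)! / ((2 * d + 1) ^ n * n !)

theorem sizeSeq_pos (d n : ℕ) : 0 < sizeSeq d n := by rw [sizeSeq]; positivity

/-- Vandermonde again, with N - 1 = (i+j) + M; the binomial of M is at least M(M-1)/2 ≥ (n+1)². This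
gain makes a convolution of n such products negligible. -/
theorem sizeSeq_mul_le {d : ℕ} (hd : 1 ≤ d) (i j : ℕ) :
    sizeSeq d i * sizeSeq d j ≤ sizeSeq d (i + j + 1) / ((i + j + 1 : ℕ) + 1) ^ 2 := by
  set n := i + j + 1 with hn
  set N := (2 * d + 1) * n + 2 * d with hN
  set M := 2 * d * (n + 1) with hM
  have hN1 : 1 ≤ N := by omega
  have hV : (i + j).choose i * M.choose (2 * d * (i + 1)) ≤
      (N - 1).choose ((2 * d + 1) * i + 2 * d) := by
    have := choose_mul_choose_le (i + j) M i (2 * d * (i + 1))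
    rwa [show i + j + M = N - 1 by rw [hM, hN, hn]; ring_nf; omega,
      show i + 2 * d * (i + 1) = (2 * d + 1) * i + 2 * d by ring] at this
  have hfac : (N - 1).choose ((2 * d + 1) * i + 2 * d) * ((2 * d + 1) * i + 2 * d)!
      * ((2 * d + 1) * j + 2 * d)! = (N - 1)! := by
    have h := Nat.add_choose_mul_factorial_mul_factorial ((2 * d + 1) * i + 2 * d)
      ((2 * d + 1) * j + 2 * d)
    rwa [← Nat.choose_symm_add, show (2 * d + 1) * i + 2 * d + ((2 * d + 1) * j + 2 * d) = N - 1 by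
      rw [hN, hn]; ring_nf; omega] at h
  have hM2 : (n + 1) ^ 2 ≤ M.choose (2 * d * (i + 1)) := by
    obtain ⟨s, hs⟩ : ∃ s, 2 * d * (i + 1) = s + 2 := ⟨2 * d * (i + 1) - 2, by
      have : 1 ≤ d * (i + 1) := Nat.mul_pos hd (Nat.succ_pos i)
      rw [mul_assoc]; omega⟩
    obtain ⟨t, ht⟩ : ∃ t, 2 * d * (j + 1) = t + 2 := ⟨2 * d * (j + 1) - 2, by
      have : 1 ≤ d * (j + 1) := Nat.mul_pos hd (Nat.succ_pos j)
      rw [mul_assoc]; omega⟩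
    have h := mul_le_two_mul_choose s t
    have e : M = s + t + 4 := by
      rw [hM, hn, show i + j + 1 + 1 = (i + 1) + (j + 1) by ring, mul_add, hs, ht]; ring
    rw [← e, ← hs] at h
    have hMn : 2 * (n + 1) ≤ M := by rw [hM]; nlinarith
    have h3 : s + t + 3 = M - 1 := by omega
    rw [h3] at h
    have h4 : 2 * n + 1 ≤ M - 1 := by omega
    have h5 : 2 * (n + 1) * (2 * n + 1) ≤ M * (M - 1) := Nat.mul_le_mul hMn h4
    nlinarith
  have hnat : (2 * d + 1) * n * (i + j).choose i * ((2 * d + 1) * i + 2 * d)!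
      * ((2 * d + 1) * j + 2 * d)! * (n + 1) ^ 2 ≤ N ! := by
    obtain ⟨F, hF⟩ : ∃ F, N = F + 1 := ⟨N - 1, by omega⟩
    rw [show N - 1 = F by omega] at hV hfac
    rw [hF, Nat.factorial_succ, ← hfac, ← hF]
    calc _ ≤ (2 * d + 1) * n * (i + j).choose i * ((2 * d + 1) * i + 2 * d)!
          * ((2 * d + 1) * j + 2 * d)! * M.choose (2 * d * (i + 1)) := by gcongr
      _ = (2 * d + 1) * n * (((i + j).choose i * M.choose (2 * d * (i + 1)))
          * ((2 * d + 1) * i + 2 * d)! * ((2 * d + 1) * j + 2 * d)!) := by ring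
      _ ≤ N * (F.choose ((2 * d + 1) * i + 2 * d) * ((2 * d + 1) * i + 2 * d)!
          * ((2 * d + 1) * j + 2 * d)!) := by gcongr; omega
  have hreal : ((2 * d + 1) * n * (i + j).choose i * ((2 * d + 1) * i + 2 * d)!
      * ((2 * d + 1) * j + 2 * d)! * (n + 1) ^ 2 : ℝ) ≤ N ! := by exact_mod_cast hnat
  have hch := cast_add_choose_left i j
  have hnf : (n ! : ℝ) = n * (i + j)! := by
    rw [hn, Nat.factorial_succ]; push_cast; ring
  rw [le_div_iff₀ (by positivity)]
  have e : sizeSeq d i * sizeSeq d j * ((n : ℝ) + 1) ^ 2 =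
      ((2 * d + 1) * n * (i + j).choose i * ((2 * d + 1) * i + 2 * d)!
      * ((2 * d + 1) * j + 2 * d)! * (n + 1) ^ 2 : ℝ) / ((2 * d + 1) ^ n * n !) := by
    have hn0 : (n : ℝ) ≠ 0 := by rw [hn]; positivity
    rw [sizeSeq, sizeSeq, hch, hnf, show (2 * (d : ℝ) + 1) ^ n
      = (2 * d + 1) ^ i * (2 * d + 1) ^ j * (2 * d + 1) by rw [hn]; ring]
    field_simp
  rw [e, sizeSeq]
  gcongr

theorem pow_mul_coeffArray {d : ℕ} (hd : 1 ≤ d) (n : ℕ) : 4 ^ d * coeffArray d d n =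
    normArray d d n * sizeSeq d n / ((2 * d + 1) * n + 2 * d) := by
  obtain ⟨F, hF⟩ : ∃ F, (2 * d + 1) * n + 2 * d = F + 1 := ⟨(2 * d + 1) * n + 2 * d - 1, by omega⟩
  have hFc : ((2 * d + 1) * n + 2 * d : ℝ) = F + 1 := by exact_mod_cast hF
  rw [coeffArray_eq, sizeSeq, hF, Nat.add_sub_cancel, Nat.factorial_succ, hFc]
  push_cast
  field_simp

theorem pow_mul_coeffArray_le {d : ℕ} (hd : 1 ≤ d) (n : ℕ) :
    4 ^ d * coeffArray d d n ≤ sizeSeq d n := by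
  rw [pow_mul_coeffArray hd]
  have h1 : normArray d d n ≤ 1 := by
    obtain ⟨k, rfl⟩ : ∃ k, d = k + 1 := ⟨d - 1, by omega⟩
    exact normArray_le_one _ _ _
  have hd' : (1 : ℝ) ≤ d := by exact_mod_cast hd
  have h2 : (1 : ℝ) ≤ (2 * d + 1) * n + 2 * d := by
    have : (0 : ℝ) ≤ (2 * d + 1) * n := by positivity
    linarith
  have hs := sizeSeq_pos d n
  rw [div_le_iff₀ (by linarith)]
  exact mul_le_mul h1 (le_mul_of_one_le_right hs.le h2) hs.le (by norm_num) |>.trans (by linarith)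

/-- The leading part of `v_{n+1}`. -/
def leadSeq (d n : ℕ) : ℝ :=
  (((2 * d + 1) * (n + 1) - 1) / 2 + 1 / 2) * (4 ^ d * coeffArray d d n)

theorem leadSeq_eq {d : ℕ} (hd : 1 ≤ d) (n : ℕ) : leadSeq d n =
    normArray d d n / 2 * (1 + 1 / ((2 * d + 1) * n + 2 * d)) * sizeSeq d n := by
  have h : ((2 * d + 1) * n + 2 * d : ℝ) ≠ 0 := by
    have hd' : (1 : ℝ) ≤ d := by exact_mod_cast hd
    positivity
  rw [leadSeq, pow_mul_coeffArray hd]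
  field_simp
  ring

theorem leadSeq_nonneg (d n : ℕ) : 0 ≤ leadSeq d n := by
  have h := coeffArray_nonneg d d n
  have e : leadSeq d n = ((2 * d + 1) * (n + 1)) / 2 * (4 ^ d * coeffArray d d n) := by
    rw [leadSeq]; ring
  rw [e]
  positivity

theorem leadSeq_le {d : ℕ} (hd : 1 ≤ d) (n : ℕ) : leadSeq d n ≤ sizeSeq d n := by
  rw [leadSeq_eq hd]
  have h1 : normArray d d n ≤ 1 := by
    obtain ⟨k, rfl⟩ : ∃ k, d = k + 1 := ⟨d - 1, by omega⟩
    exact normArray_le_one _ _ _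
  have hd' : (1 : ℝ) ≤ d := by exact_mod_cast hd
  have h2 : 1 / ((2 * d + 1) * n + 2 * d : ℝ) ≤ 1 := by
    rw [div_le_one (by positivity)]
    have : (0 : ℝ) ≤ (2 * d + 1) * n := by positivity
    linarith
  have h3 : (0 : ℝ) ≤ 1 / ((2 * d + 1) * n + 2 * d : ℝ) := by positivity
  have h0 := normArray_nonneg d d n
  refine mul_le_of_le_one_left (sizeSeq_pos d n).le ?_
  nlinarith

theorem solSeries_sub_lead_le_of_bound {d : ℕ} (hd : 1 ≤ d) (n : ℕ)
    (hb : ∀ i < n, ‖PowerSeries.coeff (i + 1) (solSeries d)‖ ≤ 2 * sizeSeq d i) :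
    ‖PowerSeries.coeff (n + 1) (solSeries d) - (leadSeq d n : ℂ)‖ ≤
      2 * n / (n + 1) ^ 2 * sizeSeq d n := by
  have e : PowerSeries.coeff (n + 1) (solSeries d) - (leadSeq d n : ℂ) =
      ∑ i ∈ Finset.range n, PowerSeries.coeff (i + 1) (solSeries d)
          * (4 ^ d * coeffArray d d (n - 1 - i) : ℝ) := by
    rw [solSeries_rec, leadSeq]
    push_cast
    ring
  rw [e]
  refine (norm_sum_le _ _).trans ?_
  have hterm : ∀ i ∈ Finset.range n, ‖PowerSeries.coeff (i + 1) (solSeries d)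
      * ((4 ^ d * coeffArray d d (n - 1 - i) : ℝ) : ℂ)‖ ≤ 2 * (sizeSeq d n / (n + 1) ^ 2) := by
    intro i hi
    have hi := Finset.mem_range.1 hi
    have hc := coeffArray_nonneg d d (n - 1 - i)
    rw [norm_mul, Complex.norm_real, Real.norm_of_nonneg (by positivity)]
    have hs := sizeSeq_mul_le hd i (n - 1 - i)
    rw [show i + (n - 1 - i) + 1 = n by omega] at hs
    calc _ ≤ 2 * sizeSeq d i * sizeSeq d (n - 1 - i) :=
          mul_le_mul (hb i hi) (pow_mul_coeffArray_le hd _) (by positivity)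
            (by have := sizeSeq_pos d i; positivity)
      _ ≤ _ := by rw [mul_assoc]; linarith
  refine (Finset.sum_le_sum hterm).trans (le_of_eq ?_)
  rw [Finset.sum_const, Finset.card_range, nsmul_eq_mul]
  ring

/-- The constant 2 reproduces itself: the leading part is at most one `sizeSeq`, and the convolution
at most 2n/(n+1)² ≤ 1 of it. -/
theorem norm_solSeries_le {d : ℕ} (hd : 1 ≤ d) (n : ℕ) :
    ‖PowerSeries.coeff (n + 1) (solSeries d)‖ ≤ 2 * sizeSeq d n := by
  induction n using Nat.strong_induction_on with
  | _ n ih =>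
    have h := solSeries_sub_lead_le_of_bound hd n ih
    have hl : ‖(leadSeq d n : ℂ)‖ ≤ sizeSeq d n := by
      rw [Complex.norm_real, Real.norm_of_nonneg (leadSeq_nonneg d n)]
      exact leadSeq_le hd n
    have h1 : 2 * (n : ℝ) / (n + 1) ^ 2 ≤ 1 := by
      rw [div_le_one (by positivity)]; nlinarith
    have h2 := mul_le_mul_of_nonneg_right h1 (sizeSeq_pos d n).le
    have h3 := norm_add_le (PowerSeries.coeff (n + 1) (solSeries d) - (leadSeq d n : ℂ))
      (leadSeq d n : ℂ)
    rw [sub_add_cancel] at h3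
    linarith

theorem tendsto_leadSeq_div {d : ℕ} (hd : 1 ≤ d) :
    Tendsto (fun n => leadSeq d n / sizeSeq d n) atTop (𝓝 (1 / Real.pi)) := by
  have hd' : (1 : ℝ) ≤ d := by exact_mod_cast hd
  have h1 : Tendsto (fun n : ℕ => 1 / ((2 * d + 1) * (n : ℝ) + 2 * d)) atTop (𝓝 0) :=
    tendsto_const_nhds.div_atTop (tendsto_atTop_add_const_right _ _
      (tendsto_natCast_atTop_atTop.const_mul_atTop (by positivity)))
  have h := ((tendsto_normArray_column hd).div_const 2).mul (h1.const_add 1)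
  rw [show 2 / Real.pi / 2 * (1 + 0) = 1 / Real.pi by ring] at h
  refine h.congr fun n => ?_
  rw [leadSeq_eq hd, mul_div_cancel_right₀ _ (sizeSeq_pos d n).ne']

theorem tendsto_solSeries_div {d : ℕ} (hd : 1 ≤ d) :
    Tendsto (fun n => PowerSeries.coeff (n + 1) (solSeries d) / (sizeSeq d n : ℂ)) atTop
      (𝓝 (1 / (Real.pi : ℂ))) := by
  have h1 : Tendsto (fun n => ((leadSeq d n / sizeSeq d n : ℝ) : ℂ)) atTop
      (𝓝 ((1 / Real.pi : ℝ) : ℂ)) :=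
    (Complex.continuous_ofReal.tendsto _).comp (tendsto_leadSeq_div hd)
  have hq : Tendsto (fun n : ℕ => 2 * (1 / ((n : ℝ) + 1))) atTop (𝓝 (2 * 0)) :=
    (tendsto_one_div_add_atTop_nhds_zero_nat (𝕜 := ℝ)).const_mul 2
  rw [mul_zero] at hq
  have h2 : Tendsto (fun n => (PowerSeries.coeff (n + 1) (solSeries d) - (leadSeq d n : ℂ))
      / (sizeSeq d n : ℂ)) atTop (𝓝 0) := by
    refine squeeze_zero_norm (fun n => ?_) hq
    have hs := sizeSeq_pos d n
    rw [norm_div, Complex.norm_real, Real.norm_of_nonneg hs.le, div_le_iff₀ hs]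
    refine (solSeries_sub_lead_le_of_bound hd n fun i _ => norm_solSeries_le hd i).trans ?_
    refine mul_le_mul_of_nonneg_right ?_ hs.le
    rw [mul_one_div, div_le_div_iff₀ (by positivity) (by positivity)]
    nlinarith
  have h := h1.add h2
  rw [add_zero] at h
  push_cast at h
  refine h.congr fun n => ?_
  rw [← add_div]
  congr 1
  ring

end PainleveII

end

theorem theorem1p3 (d : ℕ) (hd : 1 ≤ d) :
    ∃ v : ℕ → ℂ, PainleveII.IsFormalSolution d v ∧
      (∀ w : ℕ → ℂ, PainleveII.IsFormalSolution d w → w = v) ∧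
      Asymptotics.IsEquivalent Filter.atTop v (fun n : ℕ =>
        1 / (Real.pi : ℂ) * ((((2 * d + 1) * n - 1).factorial : ℂ) /
          (((2 * d + 1 : ℕ) : ℂ) ^ (n - 1) * ((n - 1).factorial : ℂ)))) := by
  refine ⟨_, PainleveII.solution_exists hd, fun w hw => PainleveII.solution_unique hd hw, ?_⟩
  have hpi : (Real.pi : ℂ) ≠ 0 := by exact_mod_cast Real.pi_ne_zero
  refine Asymptotics.isEquivalent_of_tendsto_one ?_
  -- Passing to n + 1 removes the truncated subtractions in the comparison sequence and matches
  -- `sizeSeq`.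
  refine (Filter.tendsto_add_atTop_iff_nat 1).1 ?_
  have h := (PainleveII.tendsto_solSeries_div hd).mul_const (Real.pi : ℂ)
  rw [one_div_mul_cancel hpi] at h
  refine h.congr fun n => ?_
  have hsize : ((((2 * d + 1) * (n + 1) - 1).factorial : ℂ) /
      (((2 * d + 1 : ℕ) : ℂ) ^ (n + 1 - 1) * ((n + 1 - 1).factorial : ℂ))) =
      (PainleveII.sizeSeq d n : ℂ) := by
    rw [PainleveII.sizeSeq, show (2 * d + 1) * (n + 1) - 1 = (2 * d + 1) * n + 2 * d by
      rw [mul_add]; omega, Nat.add_sub_cancel]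
    push_cast
    rfl
  have hs : (PainleveII.sizeSeq d n : ℂ) ≠ 0 := by
    exact_mod_cast (PainleveII.sizeSeq_pos d n).ne'
  simp only [Pi.div_apply]
  rw [hsize]
  field_simp
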